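/- All vector spaces are over $\mathbb{C}$, and all modules over Lie superalgebras are $\mathbb{Z}_2$-graded: an irreducible module is a nonzero module with no graded submodules other than $0$ and itself, while an isomorphism of modules is a bijective linear map commuting with the action, not required to be homogeneous. Let $n\ge 2$ and let $\mathfrak{q}=\mathfrak{q}(n)$ be the queer Lie superalgebra, i.e. the Lie superalgebra of block matrices $\begin{pmatrix}A&B\\B&A\end{pmatrix}$ with $A,B\in M_{n+1}(\mathbb{C})$, $\operatorname{tr}B=0$, with the supercommutator (block-diagonal matrices being even, block-antidiagonal ones odd), modulo $\mathbb{C}I_{2n+2}$. Let $A$ be a finitely generated commutative associative unital $\mathbb{C}$-algebra, and let $\mathfrak{q}\otimes A$ be the Lie superalgebra with bracket $[x\otimes a,y\otimes b]=[x,y]\otimes ab$ and grading $(\mathfrak{q}\otimes A)_j=\mathfrak{q}_j\otimes A$. Irreducible products. For Lie superalgebras $\mathfrak{g}^1,\mathfrak{g}^2$ and irreducible finite-dimensional $\mathfrak{g}^i$-modules $V^i$, the $\mathfrak{g}^1\oplus\mathfrak{g}^2$-module $V^1\widehat\otimes V^2$ is $V^1\otimes V^2$ if this is irreducible; otherwise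 there are odd endomorphisms $\varphi_i$ of $V^i$, supercommuting with $\mathfrak{g}^i$, with $\varphi_i^2=-\mathrm{id}$, and $$V^1\widehat\otimes V^2=\{v\in V^1\otimes V^2 \mid (\sqrt{-1}\,\varphi_1\otimes\varphi_2)v=v\},$$ where $(\sqrt{-1}\,\varphi_1\otimes\varphi_2)(v_1\otimes v_2)=(-1)^{|v_1|}\sqrt{-1}\,\varphi_1(v_1)\otimes\varphi_2(v_2)$ for homogeneous $v_1$; up to isomorphism this does not depend on the choice of the $\varphi_i$. Inductively, $V^1\widehat\otimes\cdots\widehat\otimes V^k=(V^1\widehat\otimes\cdots\widehat\otimes V^{k-1})\widehat\otimes V^k$, a module over $\mathfrak{g}^1\oplus\cdots\oplus\mathfrak{g}^k$; for $k=0$ it is the trivial one-dimensional module. Evaluation. For pairwise distinct maximal ideals $\mathsf{m}_1,\dots,\mathsf{m}_k$ of $A$ ($k\ge 0$) and irreducible finite-dimensional representations $\rho_i$ of $\mathfrak{q}\otimes A/\mathsf{m}_i$, let $\widehat{\mathrm{ev}}_{\mathsf{m}_1,\dots,\mathsf{m}_k}(\rho_1,\dots,\rho_k)$ be the representation of $\mathfrak{q}\otimes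 A$ obtained by composing the evaluation map $\mathfrak{q}\otimes A\to\bigoplus_{i=1}^k \mathfrak{q}\otimes A/\mathsf{m}_i$ with $\rho_1\widehat\otimes\cdots\widehat\otimes\rho_k$. Support. For a $\mathfrak{q}\otimes A$-module $V$, let $\mathrm{Ann}_A(V)$ be the sum of all ideals $I\subseteq A$ with $(\mathfrak{q}\otimes I)V=0$. The support of $V$ is the set of maximal ideals of $A$ containing $\mathrm{Ann}_A(V)$, and $V$ has reduced support if $\mathrm{Ann}_A(V)$ is a radical ideal (i.e. equal to its radical; $A$ itself counts as radical). Proposition. An irreducible finite-dimensional representation of $\mathfrak{q}\otimes A$ is isomorphic to a representation of the form $\widehat{\mathrm{ev}}_{\mathsf{m}_1,\dots,\mathsf{m}_k}(\rho_1,\dots,\rho_k)$ if and only if its support is finite and reduced. -/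

import Mathlib

open scoped TensorProduct

universe u v w

noncomputable section

namespace Queer

/-! ### Super vector spaces -/

/-- A `ℤ/2`-grading `V = V₀ ⊕ V₁` on a complex vector space. -/
class SuperSpace (V : Type*) [AddCommGroup V] [Module ℂ V] where
  part : ZMod 2 → Submodule ℂ V
  isCompl : IsCompl (part 0) (part 1)

/-- The sign `(-1)^(i j)` of two parities. -/
def sgn (i j : ZMod 2) : ℂ := (-1) ^ (i.val * j.val)

@[simp] theorem sgn_zero_left (j : ZMod 2) : sgn 0 j = 1 := by simp [sgn]
@[simp] theorem sgn_zero_right (i : ZMod 2) : sgn i 0 = 1 := by simp [sgn]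
@[simp] theorem sgn_one_one : sgn 1 1 = -1 := by simp [sgn, ZMod.val_one]

theorem zmod2_cases (i : ZMod 2) : i = 0 ∨ i = 1 := by
  revert i; decide

theorem zmod2_one_add_one : (1 + 1 : ZMod 2) = 0 := by decide
theorem zmod2_zero_sub_one : (0 - 1 : ZMod 2) = 1 := by decide
theorem zmod2_neg_one : (-1 : ZMod 2) = 1 := by decide

namespace SuperSpace

variable {V : Type*} [AddCommGroup V] [Module ℂ V] [SuperSpace V]

/-- The projection of `V` onto its homogeneous component of parity `i`. -/
def proj (i : ZMod 2) : V →ₗ[ℂ] V :=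
  if i = 0 then (part (V := V) 0).projection (part 1) isCompl
  else (part (V := V) 1).projection (part 0) isCompl.symm

/-- The parity operator `v ↦ (-1)^|v| v`. -/
def parity : V →ₗ[ℂ] V := proj 0 - proj 1

/-- A linear subspace is graded if it contains the homogeneous components of its elements. -/
def IsGraded (S : Submodule ℂ V) : Prop := ∀ v ∈ S, ∀ i : ZMod 2, proj i v ∈ S

theorem proj_mem (i : ZMod 2) (v : V) : proj i v ∈ part (V := V) i := by
  rcases zmod2_cases i with rfl | rfl
  · simp [proj]
  · simp [proj]

theorem proj_same {i : ZMod 2} {v : V} (h : v ∈ part (V := V) i) : proj i v = v := by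
  rcases zmod2_cases i with rfl | rfl
  · simpa [proj] using Submodule.projection_apply_of_mem_left (isCompl (V := V)) h
  · simpa [proj] using Submodule.projection_apply_of_mem_left (isCompl (V := V)).symm h

theorem proj_other {i : ZMod 2} {v : V} (h : v ∈ part (V := V) i) : proj (i + 1) v = 0 := by
  rcases zmod2_cases i with rfl | rfl
  · simpa [proj] using (Submodule.projection_apply_eq_zero_iff (isCompl (V := V)).symm).2 h
  · simpa [proj, zmod2_one_add_one] using
      (Submodule.projection_apply_eq_zero_iff (isCompl (V := V))).2 h

theorem proj_add (v : V) : proj 0 v + proj 1 v = v := by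
  have hv : v ∈ part (V := V) 0 ⊔ part 1 := by rw [isCompl.sup_eq_top]; trivial
  obtain ⟨a, ha, b, hb, rfl⟩ := Submodule.mem_sup.1 hv
  have h1 := proj_other ha
  have h2 := proj_other hb
  rw [zmod2_one_add_one] at h2
  rw [zero_add] at h1
  rw [map_add, map_add, proj_same ha, proj_same hb, h1, h2]
  simp

theorem parity_apply {i : ZMod 2} {v : V} (h : v ∈ part (V := V) i) :
    parity v = sgn i 1 • v := by
  rcases zmod2_cases i with rfl | rfl
  · have h1 := proj_other h
    rw [zero_add] at h1
    simp [parity, proj_same h, h1]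
  · have h1 := proj_other h
    rw [zmod2_one_add_one] at h1
    simp [parity, proj_same h, h1]

theorem parity_mem {i : ZMod 2} {v : V} (h : v ∈ part (V := V) i) :
    parity v ∈ part (V := V) i := by
  rw [parity_apply h]; exact Submodule.smul_mem _ _ h

theorem hom_induction {p : V → Prop} (hadd : ∀ a b, p a → p b → p (a + b))
    (h : ∀ i, ∀ v ∈ part (V := V) i, p v) (v : V) : p v := by
  rw [← proj_add v]
  exact hadd _ _ (h 0 _ (proj_mem 0 v)) (h 1 _ (proj_mem 1 v))

theorem parity_parity (v : V) : parity (parity v) = v := by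
  induction v using hom_induction with
  | hadd a b ha hb => simp [ha, hb]
  | h i v hv =>
    rw [parity_apply (parity_mem hv), parity_apply hv]
    rcases zmod2_cases i with rfl | rfl <;> simp

/-- The grading induced on a graded subspace: `S_i = S ∩ V_i`. -/
@[reducible] def sub (S : Submodule ℂ V) (hS : IsGraded S) : SuperSpace S where
  part i := (part (V := V) i).comap S.subtype
  isCompl := by
    refine IsCompl.of_eq ?_ ?_
    · rw [eq_bot_iff]
      rintro ⟨v, hv⟩ ⟨h0, h1⟩
      have := (Submodule.disjoint_def.1 (isCompl (V := V)).disjoint) v h0 h1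
      simpa using this
    · rw [eq_top_iff]
      rintro ⟨v, hv⟩ -
      have : (⟨v, hv⟩ : S) = ⟨proj 0 v, hS v hv 0⟩ + ⟨proj 1 v, hS v hv 1⟩ :=
        Subtype.ext (proj_add v).symm
      rw [this]
      exact Submodule.add_mem_sup (proj_mem 0 v) (proj_mem 1 v)

/-- The grading induced on the quotient by a graded subspace: `(V/S)_i` is the image of `V_i`. -/
@[reducible] def quot (S : Submodule ℂ V) (hS : IsGraded S) : SuperSpace (V ⧸ S) where
  part i := (part (V := V) i).map S.mkQ
  isCompl := by
    refine IsCompl.of_eq ?_ ?_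
    · rw [eq_bot_iff]
      rintro _ ⟨⟨a, ha, rfl⟩, ⟨b, hb, hab⟩⟩
      have h : b - a ∈ S := (Submodule.Quotient.eq S).1 hab
      have h0 := hS _ h 0
      have h1 := proj_other hb
      rw [zmod2_one_add_one] at h1
      rw [map_sub, h1, proj_same ha, zero_sub, neg_mem_iff] at h0
      simpa using h0
    · rw [← Submodule.map_sup, (isCompl (V := V)).sup_eq_top, Submodule.map_top,
        Submodule.range_mkQ]

end SuperSpace

open SuperSpace

/-! ### Lie superalgebras -/

/-- A complex Lie superalgebra. -/
class LieSuperalgebra (L : Type*) [AddCommGroup L] [Module ℂ L] extends SuperSpace L where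
  sbr : L →ₗ[ℂ] L →ₗ[ℂ] L
  sbr_mem : ∀ {i j : ZMod 2} {x y : L}, x ∈ part i → y ∈ part j → sbr x y ∈ part (i + j)
  skew : ∀ {i j : ZMod 2} {x y : L}, x ∈ part i → y ∈ part j →
    sbr x y = -(sgn i j • sbr y x)
  jacobi : ∀ {i j k : ZMod 2} {x y z : L}, x ∈ part i → y ∈ part j → z ∈ part k →
    sbr x (sbr y z) = sbr (sbr x y) z + sgn i j • sbr y (sbr x z)

open LieSuperalgebra

/-- A graded subspace closed under the bracket is a Lie superalgebra. -/
@[reducible] def subLie {L : Type*} [AddCommGroup L] [Module ℂ L] [LieSuperalgebra L]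
    (S : Submodule ℂ L) (hS : IsGraded S) (hb : ∀ x ∈ S, ∀ y ∈ S, sbr x y ∈ S) :
    LieSuperalgebra S where
  toSuperSpace := SuperSpace.sub S hS
  sbr := LinearMap.mk₂ ℂ (fun x y => ⟨sbr x.1 y.1, hb _ x.2 _ y.2⟩)
    (fun _ _ _ => Subtype.ext (by simp)) (fun _ _ _ => Subtype.ext (by simp))
    (fun _ _ _ => Subtype.ext (by simp)) (fun _ _ _ => Subtype.ext (by simp))
  sbr_mem hx hy := sbr_mem (L := L) hx hy
  skew hx hy := Subtype.ext (skew (L := L) hx hy)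
  jacobi hx hy hz := Subtype.ext (jacobi (L := L) hx hy hz)

/-- The quotient of a Lie superalgebra by a graded ideal. -/
@[reducible] def quotLie {L : Type*} [AddCommGroup L] [Module ℂ L] [LieSuperalgebra L]
    (J : Submodule ℂ L) (hJ : IsGraded J) (hl : ∀ x, ∀ y ∈ J, sbr x y ∈ J)
    (hr : ∀ x ∈ J, ∀ y, sbr x y ∈ J) : LieSuperalgebra (L ⧸ J) where
  toSuperSpace := SuperSpace.quot J hJ
  sbr := J.liftQ
    { toFun := fun x => J.mapQ J (sbr x) fun y hy => hl x y hy
      map_add' := fun x y => by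
        refine Submodule.linearMap_qext _ (LinearMap.ext fun z => ?_)
        simp
      map_smul' := fun c x => by
        refine Submodule.linearMap_qext _ (LinearMap.ext fun z => ?_)
        simp }
    fun x hx => by
      refine Submodule.linearMap_qext _ (LinearMap.ext fun z => ?_)
      simpa using hr x hx z
  sbr_mem := by
    rintro i j _ _ ⟨x, hx, rfl⟩ ⟨y, hy, rfl⟩
    exact ⟨sbr x y, sbr_mem hx hy, rfl⟩
  skew := by
    rintro i j _ _ ⟨x, hx, rfl⟩ ⟨y, hy, rfl⟩
    exact congrArg J.mkQ (skew hx hy)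
  jacobi := by
    rintro i j k _ _ _ ⟨x, hx, rfl⟩ ⟨y, hy, rfl⟩ ⟨z, hz, rfl⟩
    exact congrArg J.mkQ (jacobi hx hy hz)

/-- Homomorphisms of Lie superalgebras. -/
structure SuperHom (L L' : Type*) [AddCommGroup L] [Module ℂ L] [LieSuperalgebra L]
    [AddCommGroup L'] [Module ℂ L'] [LieSuperalgebra L'] extends L →ₗ[ℂ] L' where
  map_part : ∀ {i : ZMod 2} {x : L}, x ∈ part i → toLinearMap x ∈ part (V := L') i
  map_sbr : ∀ x y : L, toLinearMap (sbr x y) = sbr (toLinearMap x) (toLinearMap y)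

section Pi

variable {ι : Type*} {L : ι → Type*} [∀ i, AddCommGroup (L i)] [∀ i, Module ℂ (L i)]
  [∀ i, LieSuperalgebra (L i)]

/-- The product of a family of Lie superalgebras (for a finite family: the direct sum), with
componentwise grading and bracket. -/
instance piLieSuperalgebra : LieSuperalgebra (∀ i, L i) where
  part j := Submodule.pi Set.univ fun i => part (V := L i) j
  isCompl := by
    refine IsCompl.of_eq ?_ ?_
    · rw [eq_bot_iff]
      rintro v ⟨h0, h1⟩
      funext i
      exact (Submodule.disjoint_def.1 (isCompl (V := L i)).disjoint) (v i) (h0 i trivial)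
        (h1 i trivial)
    · rw [eq_top_iff]
      rintro v -
      have : v = (fun i => proj 0 (v i)) + (fun i => proj 1 (v i)) :=
        funext fun i => (proj_add (v i)).symm
      rw [this]
      exact Submodule.add_mem_sup (fun i _ => proj_mem 0 _) (fun i _ => proj_mem 1 _)
  sbr := LinearMap.mk₂ ℂ (fun x y i => sbr (x i) (y i))
    (fun _ _ _ => by funext i; simp) (fun _ _ _ => by funext i; simp)
    (fun _ _ _ => by funext i; simp) (fun _ _ _ => by funext i; simp)
  sbr_mem hx hy := fun i _ => sbr_mem (hx i trivial) (hy i trivial)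
  skew hx hy := funext fun i => skew (hx i trivial) (hy i trivial)
  jacobi hx hy hz := funext fun i => jacobi (hx i trivial) (hy i trivial) (hz i trivial)

/-- The projection of a product of Lie superalgebras onto a factor. -/
def projHom (i : ι) : SuperHom (∀ i, L i) (L i) where
  toLinearMap := LinearMap.proj i
  map_part hx := hx i trivial
  map_sbr _ _ := rfl

end Pi

/-! ### The queer Lie superalgebra -/

section QueerAlgebra

variable (ι : Type*)

/-- `M(m|m)`: square matrices in `2 × 2` block form. -/
abbrev BlockMatrix := Matrix (ι ⊕ ι) (ι ⊕ ι) ℂ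

variable {ι}

/-- The block-diagonal part of a matrix. -/
def evenPart : BlockMatrix ι →ₗ[ℂ] BlockMatrix ι where
  toFun X := Matrix.fromBlocks X.toBlocks₁₁ 0 0 X.toBlocks₂₂
  map_add' X Y := by ext (i | i) (j | j) <;> simp [Matrix.toBlocks₁₁, Matrix.toBlocks₂₂]
  map_smul' c X := by ext (i | i) (j | j) <;> simp [Matrix.toBlocks₁₁, Matrix.toBlocks₂₂]

/-- The block-antidiagonal part of a matrix. -/
def oddPart : BlockMatrix ι →ₗ[ℂ] BlockMatrix ι where
  toFun X := Matrix.fromBlocks 0 X.toBlocks₁₂ X.toBlocks₂₁ 0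
  map_add' X Y := by ext (i | i) (j | j) <;> simp [Matrix.toBlocks₁₂, Matrix.toBlocks₂₁]
  map_smul' c X := by ext (i | i) (j | j) <;> simp [Matrix.toBlocks₁₂, Matrix.toBlocks₂₁]

theorem evenPart_add_oddPart (X : BlockMatrix ι) : evenPart X + oddPart X = X := by
  ext (i | i) (j | j) <;>
    simp [evenPart, oddPart, Matrix.toBlocks₁₁, Matrix.toBlocks₂₂, Matrix.toBlocks₁₂,
      Matrix.toBlocks₂₁]

theorem evenPart_evenPart (X : BlockMatrix ι) : evenPart (evenPart X) = evenPart X := by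
  simp [evenPart]

theorem evenPart_oddPart (X : BlockMatrix ι) : evenPart (oddPart X) = 0 := by
  simp [evenPart, oddPart]

theorem oddPart_evenPart (X : BlockMatrix ι) : oddPart (evenPart X) = 0 := by
  simp [evenPart, oddPart]

theorem oddPart_oddPart (X : BlockMatrix ι) : oddPart (oddPart X) = oddPart X := by
  simp [oddPart]

/-- The even matrices are the block-diagonal ones, the odd matrices the block-antidiagonal ones. -/
def blockPart (i : ZMod 2) : Submodule ℂ (BlockMatrix ι) :=
  if i = 0 then LinearMap.range evenPart else LinearMap.range oddPart

theorem evenPart_of_mem {X : BlockMatrix ι} (h : X ∈ blockPart (ι := ι) 0) :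
    evenPart X = X ∧ oddPart X = 0 := by
  obtain ⟨Y, rfl⟩ : X ∈ LinearMap.range evenPart := by simpa [blockPart] using h
  exact ⟨evenPart_evenPart Y, oddPart_evenPart Y⟩

theorem oddPart_of_mem {X : BlockMatrix ι} (h : X ∈ blockPart (ι := ι) 1) :
    evenPart X = 0 ∧ oddPart X = X := by
  obtain ⟨Y, rfl⟩ : X ∈ LinearMap.range oddPart := by simpa [blockPart] using h
  exact ⟨evenPart_oddPart Y, oddPart_oddPart Y⟩

theorem mem_blockPart_zero {X : BlockMatrix ι} (h : oddPart X = 0) :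
    X ∈ blockPart (ι := ι) 0 := by
  have := evenPart_add_oddPart X
  rw [h, add_zero] at this
  simpa [blockPart] using ⟨X, this⟩

theorem mem_blockPart_one {X : BlockMatrix ι} (h : evenPart X = 0) :
    X ∈ blockPart (ι := ι) 1 := by
  have := evenPart_add_oddPart X
  rw [h, zero_add] at this
  simpa [blockPart] using ⟨X, this⟩

variable [Fintype ι]

/-- The super commutator of block matrices: `[X, Y] = X Y - (-1)^(|X||Y|) Y X` for homogeneous
`X`, `Y`, extended bilinearly. -/
def blockBracket : BlockMatrix ι →ₗ[ℂ] BlockMatrix ι →ₗ[ℂ] BlockMatrix ι :=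
  LinearMap.mk₂ ℂ
    (fun X Y => X * Y - (evenPart Y * evenPart X + evenPart Y * oddPart X
      + oddPart Y * evenPart X - oddPart Y * oddPart X))
    (fun _ _ _ => by simp only [map_add]; noncomm_ring)
    (fun _ _ _ => by simp only [map_smul, Matrix.smul_mul, Matrix.mul_smul]; module)
    (fun _ _ _ => by simp only [map_add]; noncomm_ring)
    (fun _ _ _ => by simp only [map_smul, Matrix.smul_mul, Matrix.mul_smul]; module)

theorem blockBracket_of_mem {i j : ZMod 2} {X Y : BlockMatrix ι} (hX : X ∈ blockPart (ι := ι) i)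
    (hY : Y ∈ blockPart (ι := ι) j) : blockBracket X Y = X * Y - sgn i j • (Y * X) := by
  rcases zmod2_cases i with rfl | rfl <;> rcases zmod2_cases j with rfl | rfl
  · simp [blockBracket, evenPart_of_mem hX, evenPart_of_mem hY]
  · simp [blockBracket, evenPart_of_mem hX, oddPart_of_mem hY]
  · simp [blockBracket, oddPart_of_mem hX, evenPart_of_mem hY]
  · simp [blockBracket, oddPart_of_mem hX, oddPart_of_mem hY]

theorem blockMul_mem {i j : ZMod 2} {X Y : BlockMatrix ι} (hX : X ∈ blockPart (ι := ι) i)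
    (hY : Y ∈ blockPart (ι := ι) j) : X * Y ∈ blockPart (ι := ι) (i + j) := by
  rcases zmod2_cases i with rfl | rfl <;> rcases zmod2_cases j with rfl | rfl
  · rw [← (evenPart_of_mem hX).1, ← (evenPart_of_mem hY).1]
    exact mem_blockPart_zero (by simp [evenPart, oddPart, Matrix.fromBlocks_multiply])
  · rw [← (evenPart_of_mem hX).1, ← (oddPart_of_mem hY).2]
    exact mem_blockPart_one (by simp [evenPart, oddPart, Matrix.fromBlocks_multiply])
  · rw [← (oddPart_of_mem hX).2, ← (evenPart_of_mem hY).1]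
    exact mem_blockPart_one (by simp [evenPart, oddPart, Matrix.fromBlocks_multiply])
  · rw [← (oddPart_of_mem hX).2, ← (oddPart_of_mem hY).2]
    exact mem_blockPart_zero (by simp [oddPart, Matrix.fromBlocks_multiply])

theorem blockBracket_mem {i j : ZMod 2} {X Y : BlockMatrix ι} (hX : X ∈ blockPart (ι := ι) i)
    (hY : Y ∈ blockPart (ι := ι) j) : blockBracket X Y ∈ blockPart (ι := ι) (i + j) := by
  rw [blockBracket_of_mem hX hY]
  refine Submodule.sub_mem _ (blockMul_mem hX hY) (Submodule.smul_mem _ _ ?_)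
  rw [add_comm]
  exact blockMul_mem hY hX

/-- The general linear Lie superalgebra `gl(m|m)`. -/
instance blockLie : LieSuperalgebra (BlockMatrix ι) where
  part := blockPart
  isCompl := by
    refine IsCompl.of_eq ?_ ?_
    · rw [eq_bot_iff]
      rintro X ⟨h0, h1⟩
      have := (evenPart_of_mem h0).1
      rw [(oddPart_of_mem h1).1] at this
      simpa using this.symm
    · rw [eq_top_iff]
      rintro X -
      rw [← evenPart_add_oddPart X]
      exact Submodule.add_mem_sup (mem_blockPart_zero (oddPart_evenPart X))
        (mem_blockPart_one (evenPart_oddPart X))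
  sbr := blockBracket
  sbr_mem := blockBracket_mem
  skew := by
    intro i j x y hx hy
    rw [blockBracket_of_mem hx hy, blockBracket_of_mem hy hx]
    rcases zmod2_cases i with rfl | rfl <;> rcases zmod2_cases j with rfl | rfl <;>
      simp [add_comm]
  jacobi := by
    intro i j k x y z hx hy hz
    rw [blockBracket_of_mem hx (blockBracket_mem hy hz),
      blockBracket_of_mem (blockBracket_mem hx hy) hz,
      blockBracket_of_mem hy (blockBracket_mem hx hz), blockBracket_of_mem hx hy,
      blockBracket_of_mem hy hz, blockBracket_of_mem hx hz]
    rcases zmod2_cases i with rfl | rfl <;> rcases zmod2_cases j with rfl | rfl <;>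
      rcases zmod2_cases k with rfl | rfl <;>
      simp [zmod2_one_add_one] <;> noncomm_ring

variable (ι) in
/-- Matrices of the form `(A B; B A)` with `tr B = 0`, as a subspace of `gl(m|m)`. -/
def tildeSubspace : Submodule ℂ (BlockMatrix ι) where
  carrier := {X | ∃ A B : Matrix ι ι ℂ, B.trace = 0 ∧ X = Matrix.fromBlocks A B B A}
  zero_mem' := ⟨0, 0, by simp, by simp⟩
  add_mem' := by
    rintro _ _ ⟨A, B, h, rfl⟩ ⟨C, D, h', rfl⟩
    exact ⟨A + C, B + D, by simp [h, h'], by simp [Matrix.fromBlocks_add]⟩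
  smul_mem' := by
    rintro c _ ⟨A, B, h, rfl⟩
    exact ⟨c • A, c • B, by simp [h], by simp [Matrix.fromBlocks_smul]⟩

theorem tilde_bracket_mem {X Y : BlockMatrix ι} (hX : X ∈ tildeSubspace ι)
    (hY : Y ∈ tildeSubspace ι) : blockBracket X Y ∈ tildeSubspace ι := by
  obtain ⟨A, B, h, rfl⟩ := hX
  obtain ⟨C, D, h', rfl⟩ := hY
  refine ⟨A * C + B * D - (C * A - D * B), A * D + B * C - (C * B + D * A),
    ?_, ?_⟩
  · simp only [Matrix.trace_add, Matrix.trace_sub]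
    rw [Matrix.trace_mul_comm A D, Matrix.trace_mul_comm B C]
    ring
  · simp [blockBracket, evenPart, oddPart, Matrix.fromBlocks_multiply, sub_eq_add_neg,
      Matrix.fromBlocks_add, Matrix.fromBlocks_neg, add_comm, add_assoc]

theorem tilde_isGraded : IsGraded (tildeSubspace ι) := by
  rintro _ ⟨A, B, h, rfl⟩ i
  have h0 : Matrix.fromBlocks A 0 0 A ∈ part (V := BlockMatrix ι) 0 :=
    mem_blockPart_zero (by simp [oddPart])
  have h1 : Matrix.fromBlocks 0 B B 0 ∈ part (V := BlockMatrix ι) 1 :=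
    mem_blockPart_one (by simp [evenPart])
  have hs : Matrix.fromBlocks A B B A
      = Matrix.fromBlocks A 0 0 A + Matrix.fromBlocks 0 B B 0 := by
    simp [Matrix.fromBlocks_add]
  have h01 := proj_other h0
  have h10 := proj_other h1
  rw [zero_add] at h01
  rw [zmod2_one_add_one] at h10
  rcases zmod2_cases i with rfl | rfl
  · rw [hs, map_add, proj_same h0, h10, add_zero]
    exact ⟨A, 0, by simp, rfl⟩
  · rw [hs, map_add, proj_same h1, h01, zero_add]
    exact ⟨0, B, h, rfl⟩

/-- The Lie superalgebra of matrices `(A B; B A)` with `tr B = 0`. -/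
instance tildeLie : LieSuperalgebra (tildeSubspace ι) :=
  subLie _ tilde_isGraded fun _ hx _ hy => tilde_bracket_mem hx hy

variable [DecidableEq ι]

theorem one_mem_tilde : (1 : BlockMatrix ι) ∈ tildeSubspace ι :=
  ⟨1, 0, by simp, by rw [Matrix.fromBlocks_one]⟩

variable (ι) in
/-- The line spanned by the identity matrix. -/
def scalars : Submodule ℂ (tildeSubspace ι) := ℂ ∙ (⟨1, one_mem_tilde⟩ : tildeSubspace ι)

theorem one_even : (⟨1, one_mem_tilde⟩ : tildeSubspace ι) ∈ part (V := tildeSubspace ι) 0 := by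
  change (1 : BlockMatrix ι) ∈ blockPart (ι := ι) 0
  refine mem_blockPart_zero ?_
  rw [← Matrix.fromBlocks_one]
  simp [oddPart, Matrix.toBlocks_fromBlocks₁₂, Matrix.toBlocks_fromBlocks₂₁,
    -Matrix.fromBlocks_one]

theorem scalars_isGraded : IsGraded (scalars ι) := by
  intro v hv i
  obtain ⟨c, rfl⟩ := Submodule.mem_span_singleton.1 hv
  have h01 := proj_other (one_even (ι := ι))
  rw [zero_add] at h01
  rcases zmod2_cases i with rfl | rfl
  · rw [map_smul, proj_same one_even]; exact hv
  · rw [map_smul, h01, smul_zero]; exact Submodule.zero_mem _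

theorem bracket_one (X : BlockMatrix ι) : blockBracket X 1 = 0 := by
  have h : evenPart (1 : BlockMatrix ι) = 1 ∧ oddPart (1 : BlockMatrix ι) = 0 :=
    evenPart_of_mem one_even
  simp [blockBracket, h.1, h.2, evenPart_add_oddPart]

theorem one_bracket (X : BlockMatrix ι) : blockBracket 1 X = 0 := by
  have h : evenPart (1 : BlockMatrix ι) = 1 ∧ oddPart (1 : BlockMatrix ι) = 0 :=
    evenPart_of_mem one_even
  simp [blockBracket, h.1, h.2, evenPart_add_oddPart]

end QueerAlgebra

/-- The queer Lie superalgebra `q(n)`: matrices `(A B; B A)` with `(n+1) × (n+1)` blocks and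
`tr B = 0`, modulo the scalar matrices. -/
abbrev QueerLie (n : ℕ) := tildeSubspace (Fin (n + 1)) ⧸ scalars (Fin (n + 1))

instance queerLie (n : ℕ) : LieSuperalgebra (QueerLie n) :=
  quotLie _ scalars_isGraded
    (fun x y hy => by
      obtain ⟨c, rfl⟩ := Submodule.mem_span_singleton.1 hy
      have : sbr x (⟨1, one_mem_tilde⟩ : tildeSubspace (Fin (n + 1))) = 0 :=
        Subtype.ext (bracket_one x.1)
      rw [map_smul, this, smul_zero]
      exact Submodule.zero_mem _)
    (fun x hx y => by
      obtain ⟨c, rfl⟩ := Submodule.mem_span_singleton.1 hx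
      have : sbr (⟨1, one_mem_tilde⟩ : tildeSubspace (Fin (n + 1))) y = 0 :=
        Subtype.ext (one_bracket y.1)
      rw [map_smul, LinearMap.smul_apply, this, smul_zero]
      exact Submodule.zero_mem _)

/-! ### Map superalgebras -/

section Map

variable {L : Type*} [AddCommGroup L] [Module ℂ L] [LieSuperalgebra L]
  {A : Type*} [CommRing A] [Algebra ℂ A]

/-- The parity `i` component `L_i ⊗ A` of `L ⊗ A`. -/
def mapPart (i : ZMod 2) : Submodule ℂ (L ⊗[ℂ] A) :=
  Submodule.map₂ (TensorProduct.mk ℂ L A) (part i) ⊤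

theorem eq_zero_of_eq_neg {V : Type*} [AddCommGroup V] [Module ℂ V] {t : V} (h : t = -t) :
    t = 0 := by
  have h2 : (2 : ℂ) • t = 0 := by rw [two_smul]; nth_rewrite 2 [h]; exact add_neg_cancel t
  exact (smul_eq_zero.1 h2).resolve_left two_ne_zero

theorem tmul_mem_mapPart {i : ZMod 2} {x : L} (hx : x ∈ part i) (a : A) :
    x ⊗ₜ[ℂ] a ∈ mapPart (L := L) (A := A) i :=
  Submodule.apply_mem_map₂ _ hx trivial

theorem mapPart_induction' {i : ZMod 2} {p : L ⊗[ℂ] A → Prop} (h0 : p 0)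
    (hadd : ∀ s t, p s → p t → p (s + t)) (h : ∀ x ∈ part (V := L) i, ∀ a : A, p (x ⊗ₜ a))
    {t : L ⊗[ℂ] A} (ht : t ∈ mapPart (L := L) (A := A) i) : p t := by
  suffices ∀ c : ℂ, p (c • t) by simpa using this 1
  rw [mapPart, Submodule.map₂_eq_span_image2] at ht
  induction ht using Submodule.span_induction with
  | mem _ hx =>
    obtain ⟨x, hx, a, -, rfl⟩ := hx
    intro c
    have := h x hx (c • a)
    rwa [TensorProduct.tmul_smul] at this
  | zero => intro c; rwa [smul_zero]
  | add s t _ _ hs ht => intro c; rw [smul_add]; exact hadd _ _ (hs c) (ht c)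
  | smul d s _ hs => intro c; rw [smul_smul]; exact hs _

theorem mapPart_induction {i : ZMod 2}
    {p : (t : L ⊗[ℂ] A) → t ∈ mapPart (L := L) (A := A) i → Prop}
    (h0 : p 0 (Submodule.zero_mem _))
    (hadd : ∀ s t hs ht, p s hs → p t ht → p (s + t) (Submodule.add_mem _ hs ht))
    (h : ∀ (x : L) (hx : x ∈ part (V := L) i) (a : A), p (x ⊗ₜ a) (tmul_mem_mapPart hx a))
    {t : L ⊗[ℂ] A} (ht : t ∈ mapPart (L := L) (A := A) i) : p t ht := by
  suffices ∃ ht, p t ht from this.2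
  refine mapPart_induction' (p := fun t => ∃ ht, p t ht) ⟨_, h0⟩ ?_ ?_ ht
  · rintro s t ⟨hs, hs'⟩ ⟨ht, ht'⟩
    exact ⟨_, hadd s t hs ht hs' ht'⟩
  · intro x hx a
    exact ⟨_, h x hx a⟩

/-- The bracket `[x ⊗ a, y ⊗ b] = [x, y] ⊗ a b`. -/
def mapBracket : L ⊗[ℂ] A →ₗ[ℂ] L ⊗[ℂ] A →ₗ[ℂ] L ⊗[ℂ] A :=
  TensorProduct.map₂ sbr (LinearMap.mul ℂ A)

@[simp] theorem mapBracket_tmul (x y : L) (a b : A) :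
    mapBracket (x ⊗ₜ[ℂ] a) (y ⊗ₜ[ℂ] b) = sbr x y ⊗ₜ[ℂ] (a * b) := by
  simp [mapBracket]

/-- The Lie superalgebra `L ⊗ A` for a commutative algebra `A`. -/
instance mapLie : LieSuperalgebra (L ⊗[ℂ] A) where
  part := mapPart
  isCompl := by
    have key : ∀ i : ZMod 2, ∀ t ∈ mapPart (L := L) (A := A) i,
        TensorProduct.map parity LinearMap.id t = sgn i 1 • t := by
      intro i t ht
      induction ht using mapPart_induction with
      | h0 => simp
      | hadd s t _ _ hs ht => rw [map_add, hs, ht, smul_add]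
      | h x hx a =>
        rw [TensorProduct.map_tmul, parity_apply hx, TensorProduct.smul_tmul']
        rfl
    refine IsCompl.of_eq ?_ ?_
    · rw [eq_bot_iff]
      rintro t ⟨h0, h1⟩
      have h := (key 0 t h0).symm.trans (key 1 t h1)
      rw [sgn_zero_left, sgn_one_one, one_smul, neg_one_smul] at h
      exact eq_zero_of_eq_neg h
    · rw [eq_top_iff]
      rintro t -
      induction t using TensorProduct.induction_on with
      | zero => exact Submodule.zero_mem _
      | add s t hs ht => exact Submodule.add_mem _ hs ht
      | tmul x a =>
        rw [← proj_add x, TensorProduct.add_tmul]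
        exact Submodule.add_mem_sup (tmul_mem_mapPart (proj_mem 0 x) a)
          (tmul_mem_mapPart (proj_mem 1 x) a)
  sbr := mapBracket
  sbr_mem := by
    intro i j s t hs ht
    induction hs using mapPart_induction with
    | h0 => rw [map_zero]; exact Submodule.zero_mem _
    | hadd s s' _ _ hs hs' => rw [map_add]; exact Submodule.add_mem _ hs hs'
    | h x hx a =>
      induction ht using mapPart_induction with
      | h0 => rw [map_zero]; exact Submodule.zero_mem _
      | hadd s s' _ _ hs hs' => rw [map_add]; exact Submodule.add_mem _ hs hs'
      | h y hy b => rw [mapBracket_tmul]; exact tmul_mem_mapPart (sbr_mem hx hy) _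
  skew := by
    intro i j s t hs ht
    induction hs using mapPart_induction with
    | h0 => simp
    | hadd s s' _ _ hs hs' => simp only [map_add, LinearMap.add_apply, hs, hs', smul_add, neg_add]
    | h x hx a =>
      induction ht using mapPart_induction with
      | h0 => simp
      | hadd s s' _ _ hs hs' => simp only [map_add, LinearMap.add_apply, hs, hs', smul_add, neg_add]
      | h y hy b =>
        rw [mapBracket_tmul, mapBracket_tmul, skew hx hy, mul_comm b a, TensorProduct.neg_tmul]
        rfl
  jacobi := by
    intro i j k s t u hs ht hu
    induction hs using mapPart_induction with
    | h0 => simp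
    | hadd s s' _ _ hs hs' => simp only [map_add, LinearMap.add_apply, hs, hs', smul_add]; abel
    | h x hx a =>
      induction ht using mapPart_induction with
      | h0 => simp
      | hadd s s' _ _ hs hs' => simp only [map_add, LinearMap.add_apply, hs, hs', smul_add]; abel
      | h y hy b =>
        induction hu using mapPart_induction with
        | h0 => simp
        | hadd s s' _ _ hs hs' => simp only [map_add, hs, hs', smul_add]; abel
        | h z hz c =>
          simp only [mapBracket_tmul]
          rw [jacobi hx hy hz, TensorProduct.add_tmul, mul_assoc a b c, mul_left_comm b a c]
          rfl

/-- The homomorphism `L ⊗ A → L ⊗ (A ⧸ I)`. -/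
def modHom (I : Ideal A) : SuperHom (L ⊗[ℂ] A) (L ⊗[ℂ] (A ⧸ I)) where
  toLinearMap := TensorProduct.map LinearMap.id (Ideal.Quotient.mkₐ ℂ I).toLinearMap
  map_part := by
    intro i t ht
    induction ht using mapPart_induction with
    | h0 => rw [map_zero]; exact Submodule.zero_mem _
    | hadd s s' _ _ hs hs' => rw [map_add]; exact Submodule.add_mem _ hs hs'
    | h x hx a => rw [TensorProduct.map_tmul]; exact tmul_mem_mapPart hx _
  map_sbr := by
    intro s t
    induction s using TensorProduct.induction_on with
    | zero => simp
    | add s s' hs hs' => simp only [map_add, LinearMap.add_apply, hs, hs']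
    | tmul x a =>
      induction t using TensorProduct.induction_on with
      | zero => simp
      | add s s' hs hs' => simp only [map_add, hs, hs']
      | tmul y b =>
        change TensorProduct.map _ _ (mapBracket _ _) = mapBracket _ _
        simp

/-- The evaluation map `L ⊗ A → ⨁ i, L ⊗ (A ⧸ mᵢ)` at a finite family of maximal ideals. -/
def ev {k : ℕ} (m : Fin k → MaximalSpectrum A) :
    SuperHom (L ⊗[ℂ] A) (∀ i, L ⊗[ℂ] (A ⧸ (m i).asIdeal)) where
  toLinearMap := LinearMap.pi fun i => (modHom (L := L) (m i).asIdeal).toLinearMap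
  map_part ht := fun i _ => (modHom (L := L) (m i).asIdeal).map_part ht
  map_sbr s t := funext fun i => (modHom (L := L) (m i).asIdeal).map_sbr s t

end Map

/-! ### Modules over Lie superalgebras -/

/-- A module over a Lie superalgebra: a super vector space `V` with a parity-preserving action
such that `[x, y] v = x (y v) - (-1)^(|x||y|) y (x v)`. -/
structure SuperModule (L : Type w) [AddCommGroup L] [Module ℂ L] [LieSuperalgebra L] where
  carrier : Type v
  [addCommGroup : AddCommGroup carrier]
  [module : Module ℂ carrier]
  [superSpace : SuperSpace carrier]
  act : L →ₗ[ℂ] carrier →ₗ[ℂ] carrier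
  act_mem : ∀ {i j : ZMod 2} {x : L} {v : carrier}, x ∈ part i → v ∈ part j →
    act x v ∈ part (i + j)
  act_sbr : ∀ {i j : ZMod 2} {x y : L}, x ∈ part i → y ∈ part j → ∀ v : carrier,
    act (sbr x y) v = act x (act y v) - sgn i j • act y (act x v)

namespace SuperModule

attribute [instance] addCommGroup module superSpace

variable {L : Type*} [AddCommGroup L] [Module ℂ L] [LieSuperalgebra L]

/-- `V` is irreducible: it is nonzero and has no graded submodules other than `0` and `V`. -/
def IsIrreducible (M : SuperModule L) : Prop :=
  Nontrivial M.carrier ∧ ∀ S : Submodule ℂ M.carrier, IsGraded S →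
    (∀ x : L, ∀ v ∈ S, M.act x v ∈ S) → S = ⊥ ∨ S = ⊤

/-- Isomorphism of modules. Isomorphisms are linear bijections commuting with the action; they
are not required to be homogeneous. -/
def Iso (M N : SuperModule L) : Prop :=
  ∃ f : M.carrier ≃ₗ[ℂ] N.carrier, ∀ (x : L) (v : M.carrier), f (M.act x v) = N.act x (f v)

/-- The pullback of a module along a homomorphism of Lie superalgebras. -/
def pullback {L' : Type*} [AddCommGroup L'] [Module ℂ L'] [LieSuperalgebra L']
    (f : SuperHom L' L) (M : SuperModule L) : SuperModule L' where
  carrier := M.carrier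
  act := M.act ∘ₗ f.toLinearMap
  act_mem hx hv := M.act_mem (f.map_part hx) hv
  act_sbr hx hy v := by
    simp only [LinearMap.comp_apply, f.map_sbr]
    exact M.act_sbr (f.map_part hx) (f.map_part hy) v

/-- The trivial one-dimensional (even) module. -/
def trivial (L : Type w) [AddCommGroup L] [Module ℂ L] [LieSuperalgebra L] :
    SuperModule.{v} L where
  carrier := ULift.{v} ℂ
  superSpace :=
    { part := fun i => if i = 0 then ⊤ else ⊥
      isCompl := by simpa using isCompl_top_bot }
  act := 0
  act_mem _ _ := Submodule.zero_mem _
  act_sbr _ _ _ := by simp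

/-- A graded subspace stable under the action, as a module. -/
def sub (M : SuperModule L) (S : Submodule ℂ M.carrier) (hS : IsGraded S)
    (hact : ∀ x : L, ∀ v ∈ S, M.act x v ∈ S) : SuperModule L where
  carrier := S
  superSpace := SuperSpace.sub S hS
  act :=
    { toFun := fun x => (M.act x).restrict (hact x)
      map_add' := fun x y => by ext v; simp
      map_smul' := fun c x => by ext v; simp }
  act_mem hx hv := M.act_mem hx hv
  act_sbr hx hy v := Subtype.ext (M.act_sbr hx hy v.1)

/-! ### Tensor products -/

section Tensor

variable {V W : Type*} [AddCommGroup V] [Module ℂ V] [SuperSpace V]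
  [AddCommGroup W] [Module ℂ W] [SuperSpace W]

/-- `(V ⊗ W)_k` is the sum of the subspaces `V_i ⊗ W_(k-i)`. -/
def tensorPart (k : ZMod 2) : Submodule ℂ (V ⊗[ℂ] W) :=
  ⨆ i : ZMod 2, Submodule.map₂ (TensorProduct.mk ℂ V W) (part i) (part (k - i))

theorem tmul_mem_tensorPart {i j : ZMod 2} {v : V} {w : W} (hv : v ∈ part i) (hw : w ∈ part j) :
    v ⊗ₜ[ℂ] w ∈ tensorPart (V := V) (W := W) (i + j) := by
  refine Submodule.mem_iSup_of_mem i (Submodule.apply_mem_map₂ _ hv ?_)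
  rwa [add_sub_cancel_left]

theorem tensorPart_le {k : ZMod 2} {S : Submodule ℂ (V ⊗[ℂ] W)}
    (h : ∀ i j : ZMod 2, i + j = k → ∀ v ∈ part (V := V) i, ∀ w ∈ part (V := W) j,
      v ⊗ₜ[ℂ] w ∈ S) : tensorPart (V := V) (W := W) k ≤ S :=
  iSup_le fun i => Submodule.map₂_le.2 fun v hv w hw => h i (k - i) (by abel) v hv w hw

theorem sgn_mul_sgn (i j : ZMod 2) : sgn i 1 * sgn j 1 = sgn (i + j) 1 := by
  rcases zmod2_cases i with rfl | rfl <;> rcases zmod2_cases j with rfl | rfl <;>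
    simp [zmod2_one_add_one]

/-- The grading of a tensor product of super vector spaces. -/
instance tensorSuper : SuperSpace (V ⊗[ℂ] W) where
  part := tensorPart
  isCompl := by
    have key : ∀ k : ZMod 2, ∀ t ∈ tensorPart (V := V) (W := W) k,
        TensorProduct.map parity parity t = sgn k 1 • t := by
      intro k
      refine tensorPart_le (S := LinearMap.eqLocus (TensorProduct.map (parity (V := V))
        (parity (V := W))) (sgn k 1 • LinearMap.id)) ?_
      rintro i j rfl v hv w hw
      change TensorProduct.map parity parity (v ⊗ₜ[ℂ] w) = sgn (i + j) 1 • (v ⊗ₜ[ℂ] w)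
      rw [TensorProduct.map_tmul, parity_apply hv, parity_apply hw, TensorProduct.smul_tmul_smul,
        sgn_mul_sgn]
    refine IsCompl.of_eq ?_ ?_
    · rw [eq_bot_iff]
      rintro t ⟨h0, h1⟩
      have h := (key 0 t h0).symm.trans (key 1 t h1)
      rw [sgn_zero_left, sgn_one_one, one_smul, neg_one_smul] at h
      exact eq_zero_of_eq_neg h
    · rw [eq_top_iff]
      rintro t -
      have hm : ∀ i j : ZMod 2, ∀ v ∈ part (V := V) i, ∀ w ∈ part (V := W) j,
          v ⊗ₜ[ℂ] w ∈ tensorPart (V := V) (W := W) 0 ⊔ tensorPart 1 := by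
        intro i j v hv w hw
        have h := tmul_mem_tensorPart hv hw
        rcases zmod2_cases (i + j) with h0 | h0 <;> rw [h0] at h
        · exact Submodule.mem_sup_left h
        · exact Submodule.mem_sup_right h
      induction t using TensorProduct.induction_on with
      | zero => exact Submodule.zero_mem _
      | add s t hs ht => exact Submodule.add_mem _ hs ht
      | tmul v w =>
        induction v using hom_induction with
        | hadd a b ha hb => rw [TensorProduct.add_tmul]; exact Submodule.add_mem _ ha hb
        | h i v hv =>
          induction w using hom_induction with
          | hadd a b ha hb => rw [TensorProduct.tmul_add]; exact Submodule.add_mem _ ha hb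
          | h j w hw => exact hm i j v hv w hw

end Tensor

/-- The action of `L` on `V ⊗ W`: for homogeneous `x` and `v`,
`x (v ⊗ w) = (x v) ⊗ w + (-1)^(|x||v|) v ⊗ (x w)`. -/
def tensorAct (M N : SuperModule L) :
    L →ₗ[ℂ] (M.carrier ⊗[ℂ] N.carrier) →ₗ[ℂ] (M.carrier ⊗[ℂ] N.carrier) where
  toFun x := TensorProduct.map (M.act x) LinearMap.id
    + TensorProduct.map LinearMap.id (N.act (proj 0 x))
    + TensorProduct.map parity (N.act (proj 1 x))
  map_add' x y := by
    simp only [map_add, TensorProduct.map_add_left, TensorProduct.map_add_right]; abel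
  map_smul' c x := by
    simp only [map_smul, TensorProduct.map_smul_left, TensorProduct.map_smul_right, smul_add,
      RingHom.id_apply]

theorem tensorAct_tmul (M N : SuperModule L) {i j : ZMod 2} {x : L} {v : M.carrier}
    (hx : x ∈ part i) (hv : v ∈ part j) (w : N.carrier) :
    tensorAct M N x (v ⊗ₜ[ℂ] w) = M.act x v ⊗ₜ[ℂ] w + sgn i j • (v ⊗ₜ[ℂ] N.act x w) := by
  have h := proj_other hx
  rcases zmod2_cases i with rfl | rfl
  · rw [zero_add] at h
    simp [tensorAct, h, proj_same hx]
  · rw [zmod2_one_add_one] at h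
    rcases zmod2_cases j with rfl | rfl <;>
      simp [tensorAct, h, proj_same hx, parity_apply hv, TensorProduct.neg_tmul]

theorem tensor_hom_ext {V W Z : Type*} [AddCommGroup V] [Module ℂ V] [SuperSpace V]
    [AddCommGroup W] [Module ℂ W] [AddCommGroup Z] [Module ℂ Z]
    {f g : V ⊗[ℂ] W →ₗ[ℂ] Z}
    (h : ∀ i, ∀ v ∈ part (V := V) i, ∀ w, f (v ⊗ₜ w) = g (v ⊗ₜ w)) : f = g := by
  refine TensorProduct.ext' fun v w => ?_
  induction v using hom_induction with
  | hadd a b ha hb => rw [TensorProduct.add_tmul, map_add, map_add, ha, hb]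
  | h i v hv => exact h i v hv w

/-- The tensor product of two modules. -/
def tensor {L : Type w} [AddCommGroup L] [Module ℂ L] [LieSuperalgebra L]
    (M N : SuperModule.{v} L) : SuperModule.{v} L where
  carrier := M.carrier ⊗[ℂ] N.carrier
  act := tensorAct M N
  act_mem := by
    intro i k x t hx ht
    refine tensorPart_le (S := (tensorPart (i + k)).comap (tensorAct M N x)) ?_ ht
    rintro a b rfl v hv w hw
    rw [Submodule.mem_comap, tensorAct_tmul M N hx hv]
    refine Submodule.add_mem _ ?_ (Submodule.smul_mem _ _ ?_)
    · rw [← add_assoc]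
      exact tmul_mem_tensorPart (M.act_mem hx hv) hw
    · rw [add_left_comm]
      exact tmul_mem_tensorPart hv (N.act_mem hx hw)
  act_sbr := by
    intro i j x y hx hy t
    suffices h : tensorAct M N (sbr x y) = tensorAct M N x ∘ₗ tensorAct M N y
        - sgn i j • (tensorAct M N y ∘ₗ tensorAct M N x) by
      rw [h]; rfl
    refine tensor_hom_ext fun a v hv w => ?_
    simp only [LinearMap.sub_apply, LinearMap.smul_apply, LinearMap.comp_apply,
      tensorAct_tmul M N (sbr_mem hx hy) hv, tensorAct_tmul M N hx hv, tensorAct_tmul M N hy hv,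
      map_add, map_smul, tensorAct_tmul M N hx (M.act_mem hy hv),
      tensorAct_tmul M N hy (M.act_mem hx hv), M.act_sbr hx hy, N.act_sbr hx hy,
      TensorProduct.sub_tmul, TensorProduct.tmul_sub]
    rcases zmod2_cases i with rfl | rfl <;> rcases zmod2_cases j with rfl | rfl <;>
      rcases zmod2_cases a with rfl | rfl <;>
      simp [zmod2_one_add_one, TensorProduct.neg_tmul, TensorProduct.tmul_neg] <;> abel

/-! ### Irreducible products -/

/-- `φ` is an odd endomorphism of the module `M` that supercommutes with the action and satisfies
`φ² = -1`. -/
structure IsOddStructure (M : SuperModule L) (φ : M.carrier →ₗ[ℂ] M.carrier) : Prop where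
  odd : ∀ {i : ZMod 2} {v : M.carrier}, v ∈ part i → φ v ∈ part (1 + i)
  comm : ∀ {i : ZMod 2} {x : L}, x ∈ part i → ∀ v, φ (M.act x v) = sgn 1 i • M.act x (φ v)
  sq : ∀ v, φ (φ v) = -v

/-- The operator `(√-1 φ) ⊗ ψ` on `V ⊗ W`. Since `ψ` is odd, by the sign rule it sends `v ⊗ w`
to `(-1)^|v| √-1 φ(v) ⊗ ψ(w)` for homogeneous `v`. -/
def oddTensor (M N : SuperModule L) (φ : M.carrier →ₗ[ℂ] M.carrier)
    (ψ : N.carrier →ₗ[ℂ] N.carrier) : (M.carrier ⊗[ℂ] N.carrier) →ₗ[ℂ] (M.carrier ⊗[ℂ] N.carrier) :=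
  TensorProduct.map ((Complex.I • φ) ∘ₗ parity) ψ

/-- The fixed subspace of `(√-1 φ) ⊗ ψ`. -/
def hatSubspace (M N : SuperModule L) (φ : M.carrier →ₗ[ℂ] M.carrier)
    (ψ : N.carrier →ₗ[ℂ] N.carrier) : Submodule ℂ (M.carrier ⊗[ℂ] N.carrier) :=
  LinearMap.eqLocus (oddTensor M N φ ψ) LinearMap.id

theorem oddTensor_tmul (M N : SuperModule L) (φ : M.carrier →ₗ[ℂ] M.carrier)
    (ψ : N.carrier →ₗ[ℂ] N.carrier) {i : ZMod 2} {v : M.carrier} (hv : v ∈ part i)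
    (w : N.carrier) :
    oddTensor M N φ ψ (v ⊗ₜ[ℂ] w) = (sgn i 1 * Complex.I) • (φ v ⊗ₜ[ℂ] ψ w) := by
  simp [oddTensor, parity_apply hv, TensorProduct.smul_tmul', smul_smul, mul_comm]

theorem oddTensor_proj {M N : SuperModule L} {φ : M.carrier →ₗ[ℂ] M.carrier}
    {ψ : N.carrier →ₗ[ℂ] N.carrier} (hφ : IsOddStructure M φ) (hψ : IsOddStructure N ψ)
    (i : ZMod 2) (t : M.carrier ⊗[ℂ] N.carrier) :
    oddTensor M N φ ψ (proj i t) = proj i (oddTensor M N φ ψ t) := by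
  have hmem : ∀ k : ZMod 2, ∀ t ∈ part k,
      oddTensor M N φ ψ t ∈ part k := by
    intro k t ht
    refine tensorPart_le (S := (tensorPart k).comap (oddTensor M N φ ψ)) ?_ ht
    rintro a b rfl v hv w hw
    rw [Submodule.mem_comap, oddTensor_tmul M N φ ψ hv]
    refine Submodule.smul_mem _ _ ?_
    have h := tmul_mem_tensorPart (hφ.odd hv) (hψ.odd hw)
    rwa [show (1 + a + (1 + b) : ZMod 2) = a + b by
      rw [add_add_add_comm, zmod2_one_add_one, zero_add]] at h
  induction t using hom_induction with
  | hadd a b ha hb => rw [map_add, map_add, map_add, map_add, ha, hb]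
  | h k t ht =>
    rcases zmod2_cases (i - k) with h | h
    · obtain rfl : i = k := sub_eq_zero.1 h
      rw [proj_same ht, proj_same (hmem i t ht)]
    · obtain rfl : i = k + 1 := by rw [← h]; abel
      rw [proj_other ht, proj_other (hmem k t ht), map_zero]

theorem oddTensor_act {M N : SuperModule L} {φ : M.carrier →ₗ[ℂ] M.carrier}
    {ψ : N.carrier →ₗ[ℂ] N.carrier} (hφ : IsOddStructure M φ) (hψ : IsOddStructure N ψ)
    (x : L) (t : M.carrier ⊗[ℂ] N.carrier) :
    oddTensor M N φ ψ (tensorAct M N x t) = tensorAct M N x (oddTensor M N φ ψ t) := by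
  induction x using hom_induction with
  | hadd a b ha hb => simp only [map_add, LinearMap.add_apply, ha, hb]
  | h i x hx =>
    suffices h : oddTensor M N φ ψ ∘ₗ tensorAct M N x = tensorAct M N x ∘ₗ oddTensor M N φ ψ from
      LinearMap.congr_fun h t
    refine tensor_hom_ext fun j v hv w => ?_
    simp only [LinearMap.comp_apply, tensorAct_tmul M N hx hv, map_add, map_smul,
      oddTensor_tmul M N φ ψ hv, oddTensor_tmul M N φ ψ (M.act_mem hx hv),
      tensorAct_tmul M N hx (hφ.odd hv), hφ.comm hx, hψ.comm hx]
    rcases zmod2_cases i with rfl | rfl <;> rcases zmod2_cases j with rfl | rfl <;>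
      simp [zmod2_one_add_one, TensorProduct.neg_tmul, TensorProduct.tmul_neg]

/-- The module on the fixed subspace of `(√-1 φ) ⊗ ψ` in `V ⊗ W`. -/
def hat (M N : SuperModule L) (φ : M.carrier →ₗ[ℂ] M.carrier) (ψ : N.carrier →ₗ[ℂ] N.carrier)
    (hφ : IsOddStructure M φ) (hψ : IsOddStructure N ψ) : SuperModule L :=
  (tensor M N).sub (hatSubspace M N φ ψ)
    (fun t ht i => (oddTensor_proj hφ hψ i t).trans (congrArg (proj i) ht))
    (fun x t ht => (oddTensor_act hφ hψ x t).trans (congrArg (tensorAct M N x) ht))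

/-- `P` is an irreducible product of the irreducible modules `M` and `N`: it is `M ⊗ N` if this is
irreducible; otherwise it is the submodule `{t | ((√-1 φ) ⊗ ψ) t = t}` of `M ⊗ N`, where `φ`, `ψ`
are odd endomorphisms of the modules `M`, `N` with square `-1` (they are unique up to sign, and
the isomorphism class of `P` does not depend on their choice). -/
inductive IsIrredProd (M N : SuperModule L) : SuperModule L → Prop
  | tensor (h : (tensor M N).IsIrreducible) : IsIrredProd M N (tensor M N)
  | hat (h : ¬ (SuperModule.tensor M N).IsIrreducible) (φ : M.carrier →ₗ[ℂ] M.carrier)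
      (ψ : N.carrier →ₗ[ℂ] N.carrier) (hφ : IsOddStructure M φ) (hψ : IsOddStructure N ψ) :
      IsIrredProd M N (hat M N φ ψ hφ hψ)

/-- `P` is an irreducible product `(⋯ (M₁ ⊗̂ M₂) ⊗̂ ⋯) ⊗̂ M_k`. The empty product is the trivial
one-dimensional module. -/
def IsIrredProdFamily {L : Type w} [AddCommGroup L] [Module ℂ L] [LieSuperalgebra L] :
    (k : ℕ) → (Fin k → SuperModule.{v} L) → SuperModule.{v} L → Prop
  | 0, _, P => P = trivial L
  | 1, M, P => P = M 0
  | k + 2, M, P => ∃ P', IsIrredProdFamily (k + 1) (fun i => M i.castSucc) P' ∧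
      IsIrredProd P' (M (Fin.last (k + 1))) P

/-- `P` is an irreducible product, as a module over the direct sum of the Lie superalgebras `L i`,
of modules `M i` over `L i`. Here `M i` is regarded as a module over the direct sum through the
projection to `L i`; the diagonal action on the tensor product is then the outer one. -/
def IsOuterIrredProd {k : ℕ} {L : Fin k → Type w} [∀ i, AddCommGroup (L i)]
    [∀ i, Module ℂ (L i)] [∀ i, LieSuperalgebra (L i)] (M : ∀ i, SuperModule.{v} (L i))
    (P : SuperModule.{v} (∀ i, L i)) : Prop :=
  IsIrredProdFamily k (fun i => (M i).pullback (projHom i)) P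

/-! ### Evaluation modules and supports for map superalgebras -/

section Support

variable {A : Type*} [CommRing A] [Algebra ℂ A]

/-- `V` is, up to isomorphism, an irreducible product of evaluation modules: the pullback along the
evaluation map at pairwise distinct maximal ideals `m₁, …, m_k` of an irreducible product of
irreducible finite-dimensional modules over the `L ⊗ (A ⧸ mᵢ)`. -/
def IsIrredProdOfEvaluations {L : Type w} [AddCommGroup L] [Module ℂ L]
    [LieSuperalgebra L] {A : Type u} [CommRing A] [Algebra ℂ A]
    (V : SuperModule.{v} (L ⊗[ℂ] A)) : Prop :=
  ∃ (k : ℕ) (m : Fin k → MaximalSpectrum A)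
    (W : ∀ i, SuperModule.{v} (L ⊗[ℂ] (A ⧸ (m i).asIdeal)))
    (P : SuperModule.{v} (∀ i, L ⊗[ℂ] (A ⧸ (m i).asIdeal))),
    Function.Injective m ∧
    (∀ i, (W i).IsIrreducible ∧ FiniteDimensional ℂ (W i).carrier) ∧
    IsOuterIrredProd W P ∧ V.Iso (P.pullback (ev m))

/-- `Ann_A(V)`: the sum of all ideals `I` of `A` such that `(L ⊗ I) V = 0`. -/
def annihilator (V : SuperModule (L ⊗[ℂ] A)) : Ideal A :=
  sSup {I | ∀ x : L, ∀ a ∈ I, ∀ v : V.carrier, V.act (x ⊗ₜ[ℂ] a) v = 0}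

/-- The support of `V`: the set of maximal ideals of `A` containing `Ann_A(V)`. -/
def support (V : SuperModule (L ⊗[ℂ] A)) : Set (MaximalSpectrum A) :=
  {m | V.annihilator ≤ m.asIdeal}

/-- `V` has reduced support if `Ann_A(V)` is a radical ideal. -/
def HasReducedSupport (V : SuperModule (L ⊗[ℂ] A)) : Prop := V.annihilator.IsRadical

end Support

end SuperModule

end Queer

end

/-! Suppose that V has finite reduced support. A finitely generated algebra is a Jacobson ring, so
the radical ideal Ann(V) is the intersection of the maximal ideals m₁, …, m_k of the support, and by
the Chinese remainder theorem the action factors through the evaluation map onto the direct sum of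
the L ⊗ A/mᵢ. What remains is a general fact, `exists_isOuterIrredProd`: an irreducible
finite-dimensional module over a finite direct sum of Lie superalgebras is an irreducible product of
irreducible modules over the summands. The argument is carried out for an arbitrary Lie superalgebra
L in place of q(n).

By induction it suffices to split off one summand of g ⊕ h. Choose an irreducible g-submodule X of V
and an irreducible h-submodule Y of the space of all g-maps X → V, even or not. Evaluation X ⊗ Y → V
is an even nonzero map of modules, hence surjective. If X ⊗ Y is irreducible, it is an isomorphism.
Otherwise it has a kernel, and Burnside's theorem (`evalMap_injective`) shows that X is reducible as
an ungraded module; then X has an odd involution d commuting with the action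
(`exists_odd_involution`). By irreducibility of Y, either Y ∘ d meets Y only in 0 or Y ∘ d lies in Y
(`stable_or_disjoint`). In the first case f ↦ f₀ + f₁ ∘ d embeds Y into the even maps, where
evaluation is injective because X is graded irreducible; so evaluation would be injective on X ⊗ Y,
a contradiction. In the second case composition with d is an operator c on Y, and evaluation maps
the fixed space of d ⊗ c isomorphically onto V. Up to normalisation, d and c are the odd
endomorphisms φ and ψ, and the fixed space is the irreducible product (`exists_isIrredProd`).

Conversely, a product of evaluation modules at m₁, …, m_k is annihilated by L ⊗ ⋂ mᵢ. The ring A/⋂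
mᵢ is a finite product of fields, so every ideal above ⋂ mᵢ is radical and lies in no maximal ideal
other than the mᵢ (`support_of_isIrredProdOfEvaluations`). -/

noncomputable section

namespace Queer

/-! ### Density -/

section Density

variable {ι X V U : Type*} [AddCommGroup X] [Module ℂ X] [AddCommGroup V] [Module ℂ V]
  [AddCommGroup U] [Module ℂ U]

/-- Burnside's theorem: an irreducible family of operators generates the full matrix algebra. -/
theorem adjoin_range_eq_top [FiniteDimensional ℂ X] [Nontrivial X] (a : ι → Module.End ℂ X)
    (ha : ∀ N : Submodule ℂ X, (∀ i, ∀ v ∈ N, a i v ∈ N) → N = ⊥ ∨ N = ⊤) :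
    Algebra.adjoin ℂ (Set.range a) = ⊤ := by
  set S := Algebra.adjoin ℂ (Set.range a) with hS
  have hsmul : ∀ (r : S) (v : X), r • v = r.1 v := fun r v => rfl
  have : IsScalarTower ℂ S X := ⟨fun c r v => by simp [hsmul]⟩
  have : IsSimpleModule S X := by
    rw [isSimpleModule_iff]
    refine { eq_bot_or_eq_top := fun N => ?_ }
    rcases ha (N.restrictScalars ℂ) (fun i v hv =>
      N.smul_mem (⟨a i, Algebra.subset_adjoin ⟨i, rfl⟩⟩ : S) hv) with h | h
    · left; simpa using h
    · right; simpa using h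
  rw [eq_top_iff]
  rintro e -
  -- Schur's lemma: the commutant of S consists of scalars, so every ℂ-linear `e` is linear over it,
  -- and the density theorem approximates `e` by elements of S on a finite spanning set.
  have hbij := IsSimpleModule.algebraMap_end_bijective_of_isAlgClosed (A := S) (V := X) ℂ
  let f : Module.End (Module.End S X) X :=
    { toFun := e
      map_add' := map_add e
      map_smul' := fun g v => by
        obtain ⟨c, rfl⟩ := hbij.2 g
        simp }
  obtain ⟨s, hs⟩ := Module.Finite.fg_top (R := ℂ) (M := X)
  obtain ⟨r, hr⟩ := jacobson_density f s
  have : e = r.1 := LinearMap.ext_on (s := (s : Set X)) hs fun m hm => hr m hm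
  rw [this]
  exact r.2

/-- The evaluation map `X ⊗ U → V` attached to a family `j` of linear maps `X → V`. -/
def evalMap (j : U →ₗ[ℂ] X →ₗ[ℂ] V) : X ⊗[ℂ] U →ₗ[ℂ] V := TensorProduct.lift j.flip

@[simp] theorem evalMap_tmul (j : U →ₗ[ℂ] X →ₗ[ℂ] V) (v : X) (f : U) :
    evalMap j (v ⊗ₜ f) = j f v := rfl

/-- Contraction with the coordinate functionals of a basis of X reads off the coefficients of `t` in
U. -/
theorem eq_zero_of_forall_dual (t : X ⊗[ℂ] U)
    (h : ∀ ξ : X →ₗ[ℂ] ℂ, TensorProduct.lift (LinearMap.lsmul ℂ U ∘ₗ ξ) t = 0) : t = 0 := by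
  classical
  let b := Module.Basis.ofVectorSpace ℂ X
  have key : ∀ i, TensorProduct.equivFinsuppOfBasisLeft b t i
      = TensorProduct.lift (LinearMap.lsmul ℂ U ∘ₗ b.coord i) t := by
    intro i
    clear h
    induction t using TensorProduct.induction_on with
    | zero => simp
    | add s t hs ht => simp_all
    | tmul v u => simp
  apply (TensorProduct.equivFinsuppOfBasisLeft b).injective
  ext i
  rw [key, h]
  simp

/-- If an irreducible family of operators on `X` is intertwined by all maps `j f` with operators
on `V`, then the evaluation map `X ⊗ U → V` is injective. -/
theorem evalMap_injective [FiniteDimensional ℂ X] (a : ι → Module.End ℂ X)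
    (b : ι → Module.End ℂ V)
    (ha : ∀ N : Submodule ℂ X, (∀ i, ∀ v ∈ N, a i v ∈ N) → N = ⊥ ∨ N = ⊤)
    (j : U →ₗ[ℂ] X →ₗ[ℂ] V) (hj : Function.Injective j)
    (hU : ∀ f i v, j f (a i v) = b i (j f v)) : Function.Injective (evalMap j) := by
  cases subsingleton_or_nontrivial X with
  | inl h =>
    have : Subsingleton (X ⊗[ℂ] U) := inferInstance
    exact Function.injective_of_subsingleton _
  | inr h =>
  have key : ∀ e : Module.End ℂ X, ∃ c : Module.End ℂ V, ∀ f v, j f (e v) = c (j f v) := by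
    intro e
    have he : e ∈ Algebra.adjoin ℂ (Set.range a) := by rw [adjoin_range_eq_top a ha]; trivial
    induction he using Algebra.adjoin_induction with
    | mem _ hx => obtain ⟨i, rfl⟩ := hx; exact ⟨b i, fun f => hU f i⟩
    | algebraMap r => exact ⟨algebraMap ℂ _ r, fun f v => by simp⟩
    | add x y _ _ hx hy =>
      obtain ⟨c, hc⟩ := hx
      obtain ⟨d, hd⟩ := hy
      exact ⟨c + d, fun f v => by simp [hc, hd]⟩
    | mul x y _ _ hx hy =>
      obtain ⟨c, hc⟩ := hx
      obtain ⟨d, hd⟩ := hy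
      exact ⟨c * d, fun f v => by simp [hc, hd]⟩
  rw [← LinearMap.ker_eq_bot, LinearMap.ker_eq_bot']
  intro t ht
  refine eq_zero_of_forall_dual t fun ξ => hj (LinearMap.ext fun w => ?_)
  -- The rank one operator v ↦ ξ(v) w turns evaluation into contraction with ξ: applying the
  -- matching `c` to `evalMap j t` gives the contraction of `t`, an element of U, evaluated at `w`.
  obtain ⟨c, hc⟩ := key (ξ.smulRight w)
  have h1 : j (TensorProduct.lift (LinearMap.lsmul ℂ U ∘ₗ ξ) t) w = c (evalMap j t) := by
    clear ht
    induction t using TensorProduct.induction_on with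
    | zero => simp
    | add s t hs ht => simp_all
    | tmul v u => simp [← hc]
  rw [h1, ht, map_zero, map_zero, LinearMap.zero_apply]

end Density

/-! ### Parity operators -/

namespace SuperSpace

variable {V : Type*} [AddCommGroup V] [Module ℂ V] [SuperSpace V]

/-- The homogeneous components are the eigenspaces of the parity operator. Below, gradings are
handled through this operator: even maps commute with it, odd maps anticommute. -/
theorem mem_part_iff {i : ZMod 2} {v : V} : v ∈ part (V := V) i ↔ parity v = sgn i 1 • v := by
  refine ⟨parity_apply, fun h => ?_⟩
  have h0 := proj_add v
  have h1 : proj 0 v - proj 1 v = sgn i 1 • (proj 0 v + proj 1 v) := by rw [h0]; exact h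
  rcases zmod2_cases i with rfl | rfl
  · rw [sgn_zero_left, one_smul, sub_eq_add_neg] at h1
    have h2 : proj 1 v = 0 := eq_zero_of_eq_neg (add_left_cancel h1).symm
    rw [← h0, h2, add_zero]
    exact proj_mem 0 v
  · rw [sgn_one_one, neg_one_smul, neg_add, sub_eq_add_neg] at h1
    have h2 : proj 0 v = 0 := eq_zero_of_eq_neg (add_right_cancel h1)
    rw [← h0, h2, zero_add]
    exact proj_mem 1 v

theorem proj_zero_apply (v : V) : proj 0 v = (2⁻¹ : ℂ) • (v + parity v) := by
  nth_rewrite 2 [← proj_add v]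
  simp only [parity, LinearMap.sub_apply]
  module

theorem proj_one_apply (v : V) : proj 1 v = (2⁻¹ : ℂ) • (v - parity v) := by
  nth_rewrite 2 [← proj_add v]
  simp only [parity, LinearMap.sub_apply]
  module

theorem isGraded_iff {S : Submodule ℂ V} : IsGraded S ↔ ∀ v ∈ S, parity v ∈ S := by
  refine ⟨fun h v hv => Submodule.sub_mem _ (h v hv 0) (h v hv 1), fun h v hv i => ?_⟩
  rcases zmod2_cases i with rfl | rfl
  · rw [proj_zero_apply]
    exact S.smul_mem _ (S.add_mem hv (h v hv))
  · rw [proj_one_apply]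
    exact S.smul_mem _ (S.sub_mem hv (h v hv))

theorem parity_unique {θ : V →ₗ[ℂ] V}
    (h : ∀ i, ∀ v ∈ part (V := V) i, θ v = sgn i 1 • v) (v : V) : parity v = θ v := by
  induction v using hom_induction with
  | hadd a b ha hb => rw [map_add, map_add, ha, hb]
  | h i v hv => rw [h i v hv, parity_apply hv]

/-- The grading defined by an involution. -/
@[reducible] def ofInvolution {V : Type*} [AddCommGroup V] [Module ℂ V] (θ : V →ₗ[ℂ] V)
    (hθ : ∀ v, θ (θ v) = v) : SuperSpace V where
  part i := LinearMap.eqLocus θ (sgn i 1 • LinearMap.id)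
  isCompl := by
    refine IsCompl.of_eq ?_ ?_
    · rw [eq_bot_iff]
      rintro v ⟨h0, h1⟩
      have h := h0.symm.trans h1
      simp only [sgn_zero_left, sgn_one_one, one_smul, neg_smul, LinearMap.id_apply] at h
      exact eq_zero_of_eq_neg h
    · rw [eq_top_iff]
      rintro v -
      have : v = (2⁻¹ : ℂ) • (v + θ v) + (2⁻¹ : ℂ) • (v - θ v) := by module
      rw [this]
      refine Submodule.add_mem_sup ?_ ?_
      · simp [LinearMap.mem_eqLocus, hθ, add_comm]
      · simp [LinearMap.mem_eqLocus, hθ]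

theorem parity_ofInvolution {V : Type*} [AddCommGroup V] [Module ℂ V] (θ : V →ₗ[ℂ] V)
    (hθ : ∀ v, θ (θ v) = v) (v : V) :
    letI := ofInvolution θ hθ
    parity v = θ v := by
  let _ := ofInvolution θ hθ
  exact parity_unique (fun i v hv => hv) v

theorem coe_parity_sub {S : Submodule ℂ V} (hS : IsGraded S) (v : S) :
    letI := SuperSpace.sub S hS
    (parity v).1 = parity v.1 := by
  let _ := SuperSpace.sub S hS
  have : parity v = ((parity : V →ₗ[ℂ] V).restrict (isGraded_iff.1 hS)) v := by
    refine parity_unique (fun i v hv => Subtype.ext ?_) v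
    exact parity_apply (V := V) hv
  rw [this]
  rfl

theorem proj_zero_add_proj_one_comp : (proj 0 + proj 1 : V →ₗ[ℂ] V) = LinearMap.id :=
  LinearMap.ext proj_add

end SuperSpace

open SuperSpace

theorem parity_tensor {V W : Type*} [AddCommGroup V] [Module ℂ V] [SuperSpace V]
    [AddCommGroup W] [Module ℂ W] [SuperSpace W] (t : V ⊗[ℂ] W) :
    parity t = TensorProduct.map parity parity t := by
  refine parity_unique (fun k => ?_) t
  refine SuperModule.tensorPart_le (S := LinearMap.eqLocus (TensorProduct.map (parity (V := V))
    (parity (V := W))) (sgn k 1 • LinearMap.id)) ?_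
  rintro i j rfl v hv w hw
  change TensorProduct.map parity parity (v ⊗ₜ[ℂ] w) = sgn (i + j) 1 • (v ⊗ₜ[ℂ] w)
  rw [TensorProduct.map_tmul, parity_apply hv, parity_apply hw, TensorProduct.smul_tmul_smul,
    SuperModule.sgn_mul_sgn]

/-! ### Even isomorphisms and irreducible submodules -/

namespace SuperModule

variable {L : Type*} [AddCommGroup L] [Module ℂ L] [LieSuperalgebra L]

theorem parity_act (M : SuperModule L) (x : L) (v : M.carrier) :
    parity (M.act x v) = M.act (parity x) (parity v) := by
  induction x using hom_induction with
  | hadd a b ha hb => simp only [map_add, LinearMap.add_apply, ha, hb]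
  | h i x hx =>
    induction v using hom_induction with
    | hadd a b ha hb => simp only [map_add, ha, hb]
    | h j v hv =>
      rw [parity_apply (M.act_mem hx hv), parity_apply hx, parity_apply hv]
      simp [smul_smul, mul_comm, sgn_mul_sgn]

theorem parity_act_of_mem (M : SuperModule L) {i : ZMod 2} {x : L} (hx : x ∈ part i)
    (v : M.carrier) : parity (M.act x v) = sgn i 1 • M.act x (parity v) := by
  rw [parity_act, parity_apply hx, map_smul, LinearMap.smul_apply]

/-- Isomorphisms of modules that preserve the grading. -/
def EvenIso (M N : SuperModule L) : Prop :=
  ∃ f : M.carrier ≃ₗ[ℂ] N.carrier, (∀ (x : L) (v : M.carrier), f (M.act x v) = N.act x (f v)) ∧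
    ∀ v, f (parity v) = parity (f v)

theorem EvenIso.iso {M N : SuperModule L} (h : M.EvenIso N) : M.Iso N := by
  obtain ⟨f, hf, -⟩ := h
  exact ⟨f, hf⟩

theorem EvenIso.refl (M : SuperModule L) : M.EvenIso M :=
  ⟨LinearEquiv.refl _ _, fun _ _ => rfl, fun _ => rfl⟩

theorem EvenIso.symm {M N : SuperModule L} (h : M.EvenIso N) : N.EvenIso M := by
  obtain ⟨f, hf, hp⟩ := h
  exact ⟨f.symm, fun x v => by rw [LinearEquiv.symm_apply_eq, hf, f.apply_symm_apply],
    fun v => by rw [LinearEquiv.symm_apply_eq, hp, f.apply_symm_apply]⟩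

/-- Irreducibility only concerns graded submodules, and commuting with parity ensures that their
preimages are graded. This is why the constructions below produce even isomorphisms. -/
theorem EvenIso.isIrreducible {M N : SuperModule L} (h : M.EvenIso N) (hM : M.IsIrreducible) :
    N.IsIrreducible := by
  obtain ⟨f, hf, hp⟩ := h
  have := hM.1
  refine ⟨f.symm.toEquiv.nontrivial, fun S hS hact => ?_⟩
  have h := hM.2 (S.comap f.toLinearMap)
    (isGraded_iff.2 fun v hv => by
      have := isGraded_iff.1 hS _ hv
      simpa [hp] using this)
    (fun x v hv => by simpa [hf] using hact x _ hv)
  refine h.imp (fun h => ?_) (fun h => ?_)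
  · rw [eq_bot_iff]
    intro v hv
    have : f.symm v ∈ S.comap f.toLinearMap := by simpa using hv
    rw [h] at this
    simpa using this
  · rw [eq_top_iff]
    intro v _
    have : f.symm v ∈ S.comap f.toLinearMap := by rw [h]; trivial
    simpa using this

/-- In a finite-dimensional module every nonzero submodule contains an irreducible one. -/
theorem exists_irreducible_sub (M : SuperModule L) [FiniteDimensional ℂ M.carrier]
    (S : Submodule ℂ M.carrier) (hS : S ≠ ⊥) (hg : IsGraded S)
    (hact : ∀ x : L, ∀ v ∈ S, M.act x v ∈ S) :
    ∃ (Y : Submodule ℂ M.carrier) (hYg : IsGraded Y) (hYact : ∀ x : L, ∀ v ∈ Y, M.act x v ∈ Y),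
      Y ≤ S ∧ (M.sub Y hYg hYact).IsIrreducible := by
  let p : Set (Submodule ℂ M.carrier) :=
    {Y | Y ≠ ⊥ ∧ Y ≤ S ∧ IsGraded Y ∧ ∀ x : L, ∀ v ∈ Y, M.act x v ∈ Y}
  obtain ⟨Y, ⟨hY0, hYS, hYg, hYact⟩, hmin⟩ :=
    wellFounded_lt.has_min p ⟨S, hS, le_rfl, hg, hact⟩
  refine ⟨Y, hYg, hYact, hYS, (Submodule.nontrivial_iff_ne_bot.2 hY0), fun T hT hTact => ?_⟩
  by_cases hT0 : T = ⊥
  · exact Or.inl hT0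
  right
  change Submodule ℂ Y at T
  have hle : T.map Y.subtype ≤ Y := Submodule.map_subtype_le Y T
  have hmem : T.map Y.subtype ∈ p := by
    refine ⟨?_, hle.trans hYS, isGraded_iff.2 ?_, ?_⟩
    · intro h
      exact hT0 (Submodule.map_injective_of_injective Y.injective_subtype
        (h.trans (Submodule.map_bot _).symm))
    · rintro _ ⟨v, hv, rfl⟩
      exact ⟨_, @isGraded_iff _ _ _ (SuperSpace.sub Y hYg) T |>.1 hT v hv, coe_parity_sub hYg v⟩
    · rintro x _ ⟨v, hv, rfl⟩
      exact ⟨_, hTact x v hv, rfl⟩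
  have heq : T.map Y.subtype = Y := by
    by_contra hne
    exact hmin _ hmem (lt_of_le_of_ne hle hne)
  refine (Submodule.eq_top_iff'.2 fun v => ?_ : (T : Submodule ℂ Y) = ⊤)
  have hv : v.1 ∈ T.map Y.subtype := by rw [heq]; exact v.2
  obtain ⟨w, hw, hwv⟩ := hv
  rwa [← Subtype.ext hwv]

end SuperModule

theorem sgn_comm (i j : ZMod 2) : sgn i j = sgn j i := by rw [sgn, sgn, mul_comm]

theorem parity_map {L L' : Type*} [AddCommGroup L] [Module ℂ L] [LieSuperalgebra L]
    [AddCommGroup L'] [Module ℂ L'] [LieSuperalgebra L'] (s : SuperHom L L') (x : L) :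
    parity (s.toLinearMap x) = s.toLinearMap (parity x) := by
  induction x using hom_induction with
  | hadd a b ha hb => simp only [map_add, ha, hb]
  | h i x hx => rw [parity_apply hx, parity_apply (s.map_part hx), map_smul]

theorem proj_map {L L' : Type*} [AddCommGroup L] [Module ℂ L] [LieSuperalgebra L]
    [AddCommGroup L'] [Module ℂ L'] [LieSuperalgebra L'] (s : SuperHom L L') (i : ZMod 2) (x : L) :
    proj i (s.toLinearMap x) = s.toLinearMap (proj i x) := by
  rcases zmod2_cases i with rfl | rfl
  · simp [proj_zero_apply, parity_map]
  · simp [proj_one_apply, parity_map]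

/-! ### Schur's lemma and odd involutions -/

namespace SuperModule

section Bijective

variable {L : Type*} [AddCommGroup L] [Module ℂ L] [LieSuperalgebra L]

theorem surjective_of_isIrreducible {M N : SuperModule L} (hN : N.IsIrreducible)
    (f : M.carrier →ₗ[ℂ] N.carrier) (hf : ∀ (x : L) (v : M.carrier), f (M.act x v) = N.act x (f v))
    (hp : ∀ v, f (parity v) = parity (f v)) (h0 : f ≠ 0) : Function.Surjective f := by
  rw [← LinearMap.range_eq_top]
  refine (hN.2 (LinearMap.range f) (isGraded_iff.2 ?_) ?_).resolve_left
    (fun h => h0 (LinearMap.range_eq_bot.1 h))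
  · rintro _ ⟨v, rfl⟩
    exact ⟨_, hp v⟩
  · rintro x _ ⟨v, rfl⟩
    exact ⟨_, hf x v⟩

theorem injective_of_isIrreducible {M N : SuperModule L} (hM : M.IsIrreducible)
    (f : M.carrier →ₗ[ℂ] N.carrier) (hf : ∀ (x : L) (v : M.carrier), f (M.act x v) = N.act x (f v))
    (hp : ∀ v, f (parity v) = parity (f v)) (h0 : f ≠ 0) : Function.Injective f := by
  rw [← LinearMap.ker_eq_bot]
  refine (hM.2 (LinearMap.ker f) (isGraded_iff.2 fun v hv => ?_) fun x v hv => ?_).resolve_right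
    (fun h => h0 (LinearMap.ker_eq_top.1 h))
  · rw [LinearMap.mem_ker, hp, LinearMap.mem_ker.1 hv, map_zero]
  · rw [LinearMap.mem_ker, hf, LinearMap.mem_ker.1 hv, map_zero]

/-- A module that is irreducible, but not irreducible as an ungraded module, has an odd involution
commuting with the action. -/
theorem exists_odd_involution {X : SuperModule L} (hX : X.IsIrreducible)
    {N : Submodule ℂ X.carrier} (hN : ∀ x : L, ∀ v ∈ N, X.act x v ∈ N) (h0 : N ≠ ⊥)
    (h1 : N ≠ ⊤) : ∃ d : X.carrier →ₗ[ℂ] X.carrier, (∀ x v, d (X.act x v) = X.act x (d v)) ∧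
      (∀ v, d (parity v) = -parity (d v)) ∧ ∀ v, d (d v) = v := by
  -- N' is the image of N under parity. Parity swaps N and N', so N ⊓ N' and N ⊔ N' are graded
  -- submodules, and irreducibility forces X = N ⊕ N'.
  set N' : Submodule ℂ X.carrier := N.comap parity with hN'
  have hP : ∀ v ∈ N, parity v ∈ N' := fun v hv => by
    rw [hN', Submodule.mem_comap, parity_parity]; exact hv
  have hP' : ∀ v ∈ N', parity v ∈ N := fun v hv => hv
  have hN'act : ∀ x : L, ∀ v ∈ N', X.act x v ∈ N' := fun x v hv => by
    rw [hN', Submodule.mem_comap, parity_act]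
    exact hN _ _ hv
  have hc : IsCompl N N' := by
    refine IsCompl.of_eq ?_ ?_
    · refine (hX.2 (N ⊓ N') (isGraded_iff.2 fun v hv => ⟨hP' v hv.2, hP v hv.1⟩)
        fun x v hv => ⟨hN x v hv.1, hN'act x v hv.2⟩).resolve_right fun h => h1 ?_
      rw [eq_top_iff, ← h]
      exact inf_le_left
    · refine (hX.2 (N ⊔ N') (isGraded_iff.2 fun v hv => ?_) fun x v hv => ?_).resolve_left
        fun h => h0 ?_
      · obtain ⟨a, ha, b, hb, rfl⟩ := Submodule.mem_sup.1 hv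
        rw [map_add, add_comm]
        exact Submodule.add_mem_sup (hP' b hb) (hP a ha)
      · obtain ⟨a, ha, b, hb, rfl⟩ := Submodule.mem_sup.1 hv
        rw [map_add]
        exact Submodule.add_mem_sup (hN x a ha) (hN'act x b hb)
      · rw [eq_bot_iff, ← h]
        exact le_sup_left
  -- The involution is 1 on N and -1 on N'; it anticommutes with parity because parity exchanges the
  -- two summands.
  let d : X.carrier →ₗ[ℂ] X.carrier := N.projection N' hc - N'.projection N hc.symm
  have hd : ∀ v ∈ N, d v = v := fun v hv => by
    simp [d, Submodule.projection_apply_of_mem_left hc hv,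
      (Submodule.projection_apply_eq_zero_iff hc.symm).2 hv]
  have hd' : ∀ v ∈ N', d v = -v := fun v hv => by
    simp [d, Submodule.projection_apply_of_mem_left hc.symm hv,
      (Submodule.projection_apply_eq_zero_iff hc).2 hv]
  have key : ∀ v, ∃ a ∈ N, ∃ b ∈ N', a + b = v := fun v =>
    Submodule.mem_sup.1 (by rw [hc.sup_eq_top]; trivial)
  refine ⟨d, fun x v => ?_, fun v => ?_, fun v => ?_⟩ <;>
    obtain ⟨a, ha, b, hb, rfl⟩ := key v
  · simp only [map_add, hd a ha, hd' b hb, hd _ (hN x a ha), hd' _ (hN'act x b hb), map_neg]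
  · simp only [map_add, hd a ha, hd' b hb, hd' _ (hP a ha), hd _ (hP' b hb), map_neg]
    abel
  · simp only [map_add, hd a ha, hd' b hb, map_neg]
    simp

end Bijective

/-! ### Multiplicity spaces and the evaluation map -/

variable {L : Type w} [AddCommGroup L] [Module ℂ L] [LieSuperalgebra L]

/-- `j` identifies `Y` with a space of maps `X → V` that intertwine the action on `X` with the
action on `V` through `s`; the action on `Y` is induced by the action on `V` through `t`. -/
structure IsMultiplicity (s t : SuperHom L L) (X Y V : SuperModule.{v} L)
    (j : Y.carrier →ₗ[ℂ] X.carrier →ₗ[ℂ] V.carrier) : Prop where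
  inj : Function.Injective j
  parity : ∀ f v, j (parity f) v = parity (j f (parity v))
  act_left : ∀ f x v, j f (X.act x v) = V.act (s.toLinearMap x) (j f v)
  act_right : ∀ {i k : ZMod 2} {x : L} {v : X.carrier}, x ∈ part i → v ∈ part k → ∀ f,
    j (Y.act x f) v = sgn i k • V.act (t.toLinearMap x) (j f v)

namespace IsMultiplicity

variable {s t : SuperHom L L} {X Y V : SuperModule.{v} L}
  {j : Y.carrier →ₗ[ℂ] X.carrier →ₗ[ℂ] V.carrier}

theorem evalMap_parity (h : IsMultiplicity s t X Y V j) (u : X.carrier ⊗[ℂ] Y.carrier) :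
    evalMap j (SuperSpace.parity u) = SuperSpace.parity (evalMap j u) := by
  rw [parity_tensor]
  induction u using TensorProduct.induction_on with
  | zero => simp
  | add a b ha hb => simp only [map_add, ha, hb]
  | tmul v f => simp [h.parity, parity_parity]

/-- The sign (-1)^(|x||v|) from moving x past v in v ⊗ f cancels against the same sign in
`act_right`. -/
theorem evalMap_act (h : IsMultiplicity s t X Y V j)
    (hV : ∀ x v, V.act x v = V.act (s.toLinearMap x) v + V.act (t.toLinearMap x) v)
    (x : L) (u : X.carrier ⊗[ℂ] Y.carrier) :
    evalMap j (tensorAct X Y x u) = V.act x (evalMap j u) := by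
  induction x using hom_induction with
  | hadd a b ha hb => simp only [map_add, LinearMap.add_apply, ha, hb]
  | h i x hx =>
    suffices hs : evalMap j ∘ₗ tensorAct X Y x = V.act x ∘ₗ evalMap j from
      LinearMap.congr_fun hs u
    refine tensor_hom_ext fun k v hv f => ?_
    simp only [LinearMap.comp_apply, tensorAct_tmul X Y hx hv, map_add, map_smul, evalMap_tmul,
      h.act_left, h.act_right hx hv, hV x, smul_smul]
    rcases zmod2_cases i with rfl | rfl <;> rcases zmod2_cases k with rfl | rfl <;> simp

/-- The evaluation map is injective if `X` is irreducible as an ungraded module. -/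
theorem evalMap_injective_of_simple (h : IsMultiplicity s t X Y V j)
    [FiniteDimensional ℂ X.carrier]
    (hX : ∀ N : Submodule ℂ X.carrier, (∀ x, ∀ v ∈ N, X.act x v ∈ N) → N = ⊥ ∨ N = ⊤) :
    Function.Injective (evalMap j) :=
  evalMap_injective (fun x => X.act x) (fun x => V.act (s.toLinearMap x)) hX j h.inj h.act_left

end IsMultiplicity

/-- The evaluation map is injective on a space of even maps. -/
theorem evalMap_injective_of_even {X V : SuperModule L} {U : Type*} [AddCommGroup U] [Module ℂ U]
    [FiniteDimensional ℂ X.carrier] (hX : X.IsIrreducible) (s : SuperHom L L)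
    (j : U →ₗ[ℂ] X.carrier →ₗ[ℂ] V.carrier) (hj : Function.Injective j)
    (hp : ∀ f v, j f (parity v) = parity (j f v))
    (hact : ∀ f x v, j f (X.act x v) = V.act (s.toLinearMap x) (j f v)) :
    Function.Injective (evalMap j) := by
  -- Parity is adjoined to the operators as the index `none`. The subspaces stable under the
  -- enlarged family are exactly the graded submodules, so the ungraded density argument applies;
  -- the maps `j f` respect the extra operator because they are even.
  refine evalMap_injective (ι := Option L) (fun i => i.elim parity fun x => X.act x)
    (fun i => i.elim parity fun x => V.act (s.toLinearMap x)) (fun N hN => ?_) j hj ?_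
  · exact hX.2 N (isGraded_iff.2 fun v hv => hN none v hv) fun x v hv => hN (some x) v hv
  · rintro f (_ | x) v
    · exact hp f v
    · exact hact f x v

namespace IsMultiplicity

variable {s t : SuperHom L L} {X Y V : SuperModule.{v} L}
  {j : Y.carrier →ₗ[ℂ] X.carrier →ₗ[ℂ] V.carrier}

theorem proj_zero_apply (h : IsMultiplicity s t X Y V j) (f : Y.carrier) (v : X.carrier) :
    j (proj 0 f) v = (2⁻¹ : ℂ) • (j f v + SuperSpace.parity (j f (SuperSpace.parity v))) := by
  simp [SuperSpace.proj_zero_apply, h.parity]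

theorem proj_one_apply (h : IsMultiplicity s t X Y V j) (f : Y.carrier) (v : X.carrier) :
    j (proj 1 f) v = (2⁻¹ : ℂ) • (j f v - SuperSpace.parity (j f (SuperSpace.parity v))) := by
  simp [SuperSpace.proj_one_apply, h.parity]

variable {d : X.carrier →ₗ[ℂ] X.carrier}

theorem parity_comp (h : IsMultiplicity s t X Y V j)
    (hdp : ∀ v, d (SuperSpace.parity v) = -SuperSpace.parity (d v)) {f g : Y.carrier}
    (hg : j g = j f ∘ₗ d) : j (-SuperSpace.parity g) = j (SuperSpace.parity f) ∘ₗ d := by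
  ext v
  rw [map_neg, LinearMap.neg_apply, h.parity, hg, LinearMap.comp_apply, LinearMap.comp_apply,
    h.parity, hdp, map_neg, map_neg, neg_neg]

/-- The action on Y carries the sign (-1)^(|x||v|), and `d v` has parity opposite to that of `v`;
this leaves the factor (-1)^|x| of an odd operator supercommuting with the action. -/
theorem act_comp (h : IsMultiplicity s t X Y V j)
    (hdp : ∀ v, d (SuperSpace.parity v) = -SuperSpace.parity (d v)) {f g : Y.carrier}
    (hg : j g = j f ∘ₗ d) {i : ZMod 2} {x : L} (hx : x ∈ part i) :
    j (sgn i 1 • Y.act x g) = j (Y.act x f) ∘ₗ d := by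
  ext v
  induction v using hom_induction with
  | hadd a b ha hb => rw [map_add, map_add, ha, hb]
  | h k v hv =>
    have hdv : d v ∈ part (V := X.carrier) (k + 1) := by
      have := hdp v
      rw [parity_apply hv, map_smul] at this
      rw [mem_part_iff, ← neg_inj, ← this]
      rcases zmod2_cases k with rfl | rfl <;> simp [zmod2_one_add_one]
    rw [map_smul, LinearMap.smul_apply, h.act_right hx hv, LinearMap.comp_apply,
      h.act_right hx hdv, hg, LinearMap.comp_apply, smul_smul]
    congr 1
    rcases zmod2_cases i with rfl | rfl <;> rcases zmod2_cases k with rfl | rfl <;>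
      simp [zmod2_one_add_one]

/-- Either composition with the odd involution `d` preserves `Y`, or it carries no nonzero element
of `Y` into `Y`. -/
theorem stable_or_disjoint (h : IsMultiplicity s t X Y V j) (hY : Y.IsIrreducible)
    (hdp : ∀ v, d (SuperSpace.parity v) = -SuperSpace.parity (d v)) :
    (∀ f, ∃ g, j g = j f ∘ₗ d) ∨ ∀ f g, j g = j f ∘ₗ d → f = 0 := by
  -- Z consists of the elements of Y that composition with `d` carries back into Y. By the two
  -- preceding lemmas it is a graded submodule, hence 0 or Y.
  let Z : Submodule ℂ Y.carrier := (LinearMap.range j).comap (LinearMap.lcomp ℂ V.carrier d ∘ₗ j)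
  have hZ : ∀ f, f ∈ Z ↔ ∃ g, j g = j f ∘ₗ d := fun f => Iff.rfl
  have hZg : IsGraded Z := isGraded_iff.2 fun f hf => by
    obtain ⟨g, hg⟩ := (hZ f).1 hf
    exact (hZ _).2 ⟨_, h.parity_comp hdp hg⟩
  have hZact : ∀ x : L, ∀ f ∈ Z, Y.act x f ∈ Z := fun x f hf => by
    obtain ⟨g, hg⟩ := (hZ f).1 hf
    rw [← proj_add x, map_add, LinearMap.add_apply]
    exact Z.add_mem ((hZ _).2 ⟨_, h.act_comp hdp hg (proj_mem 0 x)⟩)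
      ((hZ _).2 ⟨_, h.act_comp hdp hg (proj_mem 1 x)⟩)
  rcases hY.2 Z hZg hZact with hz | hz
  · right
    intro f g hg
    have : f ∈ Z := (hZ f).2 ⟨g, hg⟩
    rwa [hz, Submodule.mem_bot] at this
  · left
    intro f
    rw [← hZ, hz]
    exact Submodule.mem_top

/-- The operator `1 ⊗ p₀ + d ⊗ p₁` on `X ⊗ Y`. -/
def evenShift (Y : SuperModule.{v} L) (d : X.carrier →ₗ[ℂ] X.carrier) :
    X.carrier ⊗[ℂ] Y.carrier →ₗ[ℂ] X.carrier ⊗[ℂ] Y.carrier :=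
  TensorProduct.map LinearMap.id (proj 0) + TensorProduct.map d (proj 1)

theorem proj_proj_same {W : Type*} [AddCommGroup W] [Module ℂ W] [SuperSpace W] (i : ZMod 2)
    (f : W) : proj i (proj i f) = proj i f := proj_same (proj_mem i f)

theorem proj_one_proj_zero {W : Type*} [AddCommGroup W] [Module ℂ W] [SuperSpace W]
    (f : W) : proj 1 (proj 0 f) = 0 := proj_other (i := 0) (proj_mem 0 f)

theorem proj_zero_proj_one {W : Type*} [AddCommGroup W] [Module ℂ W] [SuperSpace W]
    (f : W) : proj 0 (proj 1 f) = 0 := by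
  have := proj_other (i := 1) (proj_mem 1 f)
  rwa [zmod2_one_add_one] at this

theorem evenShift_evenShift (hdd : ∀ v, d (d v) = v) (u : X.carrier ⊗[ℂ] Y.carrier) :
    evenShift Y d (evenShift Y d u) = u := by
  induction u using TensorProduct.induction_on with
  | zero => simp
  | add a b ha hb => simp only [map_add, ha, hb]
  | tmul v f =>
    simp [evenShift, proj_proj_same, proj_one_proj_zero, proj_zero_proj_one, hdd,
      ← TensorProduct.tmul_add, proj_add]

/-- The space of even intertwiners. -/
def evenIntertwiners (s : SuperHom L L) (X V : SuperModule.{v} L) :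
    Submodule ℂ (X.carrier →ₗ[ℂ] V.carrier) where
  carrier := {f | (∀ v, f (SuperSpace.parity v) = SuperSpace.parity (f v)) ∧
    ∀ x v, f (X.act x v) = V.act (s.toLinearMap x) (f v)}
  zero_mem' := by simp
  add_mem' := by
    rintro f g ⟨hf, hf'⟩ ⟨hg, hg'⟩
    exact ⟨fun v => by simp [hf, hg], fun x v => by simp [hf', hg']⟩
  smul_mem' := by
    rintro c f ⟨hf, hf'⟩
    exact ⟨fun v => by simp [hf], fun x v => by simp [hf']⟩

/-- The composite of an odd map with the odd involution `d` is even, and it still intertwines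
because `d` commutes with the action. -/
theorem act_left_proj (h : IsMultiplicity s t X Y V j) (f : Y.carrier)
    (hdact : ∀ x v, d (X.act x v) = X.act x (d v))
    (hdp : ∀ v, d (SuperSpace.parity v) = -SuperSpace.parity (d v)) :
    j (proj 0 f) + j (proj 1 f) ∘ₗ d ∈ evenIntertwiners s X V := by
  refine ⟨fun v => ?_, fun x v => ?_⟩
  · simp only [LinearMap.add_apply, LinearMap.comp_apply, h.proj_zero_apply, h.proj_one_apply,
      hdp, map_add, map_smul, map_neg, parity_parity, map_sub]
    module
  · simp only [LinearMap.add_apply, LinearMap.comp_apply, hdact, h.act_left, map_add]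

/-- The linear map `f ↦ f₀ + f₁ ∘ d` from `Y` to the even intertwiners. -/
def toEven (h : IsMultiplicity s t X Y V j)
    (hdact : ∀ x v, d (X.act x v) = X.act x (d v))
    (hdp : ∀ v, d (SuperSpace.parity v) = -SuperSpace.parity (d v)) :
    Y.carrier →ₗ[ℂ] evenIntertwiners s X V :=
  (j ∘ₗ proj 0 + LinearMap.lcomp ℂ V.carrier d ∘ₗ j ∘ₗ proj 1).codRestrict _
    fun f => h.act_left_proj f hdact hdp

theorem toEven_apply (h : IsMultiplicity s t X Y V j)
    (hdact : ∀ x v, d (X.act x v) = X.act x (d v))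
    (hdp : ∀ v, d (SuperSpace.parity v) = -SuperSpace.parity (d v)) (f : Y.carrier)
    (v : X.carrier) :
    (h.toEven hdact hdp f).1 v = j (proj 0 f) v + j (proj 1 f) (d v) := rfl

/-- As d² = 1, evaluating an odd map f₁ at v is the same as evaluating the even map f₁ ∘ d at d v.
Evaluation on X ⊗ Y is thereby reduced to evaluation of even maps. -/
theorem evalMap_eq (h : IsMultiplicity s t X Y V j)
    (hdact : ∀ x v, d (X.act x v) = X.act x (d v))
    (hdp : ∀ v, d (SuperSpace.parity v) = -SuperSpace.parity (d v)) (hdd : ∀ v, d (d v) = v)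
    (u : X.carrier ⊗[ℂ] Y.carrier) :
    evalMap j u = evalMap (evenIntertwiners s X V).subtype
      (TensorProduct.map LinearMap.id (h.toEven hdact hdp) (evenShift Y d u)) := by
  induction u using TensorProduct.induction_on with
  | zero => simp
  | add a b ha hb => simp only [map_add, ha, hb]
  | tmul v f =>
    nth_rewrite 1 [← proj_add f]
    simp [evenShift, toEven_apply, proj_proj_same, proj_one_proj_zero, proj_zero_proj_one, hdd]

theorem evalMap_even_injective (s : SuperHom L L) (V : SuperModule.{v} L)
    [FiniteDimensional ℂ X.carrier] (hX : X.IsIrreducible) :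
    Function.Injective (evalMap (evenIntertwiners s X V).subtype) :=
  evalMap_injective_of_even hX s _ (Submodule.injective_subtype _) (fun f => f.2.1)
    fun f => f.2.2

/-- If f₀ + f₁ ∘ d = 0, then f₁ ∘ d = -f₀ lies in Y, so f₁ = 0 by disjointness and then f₀ = 0.
Hence `toEven` is injective, and it stays so after tensoring with X; `evenShift` is an involution,
and evaluation is injective on even maps. -/
theorem evalMap_injective_of_disjoint (h : IsMultiplicity s t X Y V j)
    [FiniteDimensional ℂ X.carrier] (hX : X.IsIrreducible)
    (hdact : ∀ x v, d (X.act x v) = X.act x (d v))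
    (hdp : ∀ v, d (SuperSpace.parity v) = -SuperSpace.parity (d v)) (hdd : ∀ v, d (d v) = v)
    (hdis : ∀ f g, j g = j f ∘ₗ d → f = 0) : Function.Injective (evalMap j) := by
  have hθ : Function.Injective (h.toEven hdact hdp) := by
    rw [← LinearMap.ker_eq_bot, LinearMap.ker_eq_bot']
    intro f hf
    have hf' : j (proj 0 f) + j (proj 1 f) ∘ₗ d = 0 := congrArg Subtype.val hf
    have h1 : proj 1 f = 0 := hdis _ (-proj 0 f) (by rw [map_neg, neg_eq_of_add_eq_zero_right hf'])
    rw [h1, map_zero, LinearMap.zero_comp, add_zero] at hf'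
    rw [← proj_add f, h1, h.inj (hf'.trans (map_zero j).symm), add_zero]
  have hl : Function.Injective
      (TensorProduct.map (LinearMap.id : X.carrier →ₗ[ℂ] X.carrier) (h.toEven hdact hdp)) :=
    Module.Flat.lTensor_preserves_injective_linearMap _ hθ
  rw [show (evalMap j : _ → _) = evalMap (evenIntertwiners s X V).subtype ∘
      TensorProduct.map LinearMap.id (h.toEven hdact hdp) ∘ evenShift Y d from
    funext fun u => h.evalMap_eq hdact hdp hdd u]
  exact (evalMap_even_injective s V hX).comp
    (hl.comp (Function.LeftInverse.injective (evenShift_evenShift hdd)))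

end IsMultiplicity

end SuperModule

/-! ### The module of intertwiners -/

namespace SuperModule

section HomModule

/-- The grading of the space of linear maps between super vector spaces. -/
@[reducible] def homSuper (V W : Type*) [AddCommGroup V] [Module ℂ V] [SuperSpace V]
    [AddCommGroup W] [Module ℂ W] [SuperSpace W] : SuperSpace (V →ₗ[ℂ] W) :=
  ofInvolution (LinearMap.llcomp ℂ V W W parity ∘ₗ LinearMap.lcomp ℂ W parity)
    fun f => LinearMap.ext fun v => by simp [parity_parity]

theorem parity_homSuper {V W : Type*} [AddCommGroup V] [Module ℂ V] [SuperSpace V]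
    [AddCommGroup W] [Module ℂ W] [SuperSpace W] (f : V →ₗ[ℂ] W) (v : V) :
    letI := homSuper V W
    parity f v = parity (f (parity v)) := by
  rw [parity_ofInvolution]
  rfl

variable {L : Type w} [AddCommGroup L] [Module ℂ L] [LieSuperalgebra L]

/-- The action of `L` on linear maps `X → V` through `t` and the action on `V`, with the sign
`(-1)^(|x||v|)`. -/
def homAct (t : SuperHom L L) (X V : SuperModule.{v} L) :
    L →ₗ[ℂ] (X.carrier →ₗ[ℂ] V.carrier) →ₗ[ℂ] (X.carrier →ₗ[ℂ] V.carrier) :=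
  LinearMap.llcomp ℂ X.carrier V.carrier V.carrier ∘ₗ V.act ∘ₗ t.toLinearMap ∘ₗ proj 0 +
    (LinearMap.lcomp ℂ (X.carrier →ₗ[ℂ] V.carrier) (LinearMap.lcomp ℂ V.carrier parity)) ∘ₗ
      LinearMap.llcomp ℂ X.carrier V.carrier V.carrier ∘ₗ V.act ∘ₗ t.toLinearMap ∘ₗ proj 1

variable (t : SuperHom L L) (X V : SuperModule.{v} L)

theorem homAct_apply (x : L) (f : X.carrier →ₗ[ℂ] V.carrier) (v : X.carrier) :
    homAct t X V x f v = V.act (t.toLinearMap (proj 0 x)) (f v)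
      + V.act (t.toLinearMap (proj 1 x)) (f (parity v)) := rfl

theorem homAct_apply_of_mem {i k : ZMod 2} {x : L} {v : X.carrier}
    (hx : x ∈ part i) (hv : v ∈ part k) (f : X.carrier →ₗ[ℂ] V.carrier) :
    homAct t X V x f v = sgn i k • V.act (t.toLinearMap x) (f v) := by
  have h := proj_other hx
  rw [homAct_apply, parity_apply hv]
  rcases zmod2_cases i with rfl | rfl
  · rw [zero_add] at h
    simp [h, proj_same hx]
  · rw [zmod2_one_add_one] at h
    simp [h, proj_same hx, sgn_comm 1]

theorem homAct_idempotent (ht : ∀ x, t.toLinearMap (t.toLinearMap x) = t.toLinearMap x) (x : L)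
    (f : X.carrier →ₗ[ℂ] V.carrier) : homAct t X V (t.toLinearMap x) f = homAct t X V x f := by
  ext v
  rw [homAct_apply, homAct_apply, proj_map, proj_map, ht, ht]

/-- The module of linear maps `X → V`, where `L` acts through `t` and its action on `V`. -/
def homModule : SuperModule.{v} L where
  carrier := X.carrier →ₗ[ℂ] V.carrier
  superSpace := homSuper X.carrier V.carrier
  act := homAct t X V
  act_mem := by
    intro i k x f hx hf
    let _ := homSuper X.carrier V.carrier
    have hf' : ∀ v, parity (f (parity v)) = sgn k 1 • f v := fun v => LinearMap.congr_fun hf v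
    rw [mem_part_iff]
    ext v
    rw [parity_homSuper, LinearMap.smul_apply]
    induction v using hom_induction with
    | hadd a b ha hb => simp only [map_add, smul_add, ha, hb]
    | h l v hv =>
      rw [homAct_apply_of_mem t X V hx (parity_mem hv), homAct_apply_of_mem t X V hx hv, map_smul,
        parity_act_of_mem V (t.map_part hx), hf', map_smul, ← sgn_mul_sgn, smul_smul, smul_smul, smul_smul]
      congr 1
      ring
  act_sbr := by
    intro i k x y hx hy f
    ext v
    rw [LinearMap.sub_apply, LinearMap.smul_apply]
    induction v using hom_induction with
    | hadd a b ha hb => simp only [map_add, smul_add, ha, hb]; abel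
    | h l v hv =>
      rw [homAct_apply_of_mem t X V (LieSuperalgebra.sbr_mem hx hy) hv, homAct_apply_of_mem t X V hx hv,
        homAct_apply_of_mem t X V hy hv, homAct_apply_of_mem t X V hy hv, homAct_apply_of_mem t X V hx hv,
        t.map_sbr, V.act_sbr (t.map_part hx) (t.map_part hy), map_smul, map_smul]
      rcases zmod2_cases i with rfl | rfl <;> rcases zmod2_cases k with rfl | rfl <;>
        rcases zmod2_cases l with rfl | rfl <;> simp [zmod2_one_add_one] <;> abel

/-- The space of maps `X → V` that intertwine the action on `X` with the action on `V`
through `s`. -/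
def intertwiners (s : SuperHom L L) :
    Submodule ℂ (X.carrier →ₗ[ℂ] V.carrier) where
  carrier := {f | ∀ x v, f (X.act x v) = V.act (s.toLinearMap x) (f v)}
  zero_mem' := by simp
  add_mem' hf hg x v := by simp [hf x v, hg x v]
  smul_mem' c f hf x v := by simp [hf x v]

theorem act_comm_of_sbr_eq_zero {i k : ZMod 2} {x y : L}
    (hx : x ∈ part i) (hy : y ∈ part k) (h : LieSuperalgebra.sbr x y = 0) (v : V.carrier) :
    V.act x (V.act y v) = sgn i k • V.act y (V.act x v) := by
  have := V.act_sbr hx hy v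
  rw [h, map_zero, LinearMap.zero_apply] at this
  exact sub_eq_zero.1 this.symm

theorem isGraded_intertwiners (s : SuperHom L L) :
    letI := homSuper X.carrier V.carrier
    IsGraded (intertwiners X V s) := by
  let _ := homSuper X.carrier V.carrier
  refine isGraded_iff.2 fun f hf x v => ?_
  rw [parity_homSuper, parity_homSuper, parity_act, hf, parity_act, ← parity_map, parity_parity]

/-- Passing from v to x v changes the sign in `homAct` by (-1)^(|x||y|), which is the sign produced
when the supercommuting operators of `s x` and `t y` are exchanged. -/
theorem homAct_mem_intertwiners {s : SuperHom L L}
    (hst : ∀ x y, LieSuperalgebra.sbr (s.toLinearMap x) (t.toLinearMap y) = 0)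
    (y : L) {f : X.carrier →ₗ[ℂ] V.carrier}
    (hf : f ∈ intertwiners X V s) : homAct t X V y f ∈ intertwiners X V s := by
  suffices h : ∀ k, ∀ y ∈ part (V := L) k, homAct t X V y f ∈ intertwiners X V s by
    rw [← proj_add y, map_add, LinearMap.add_apply]
    exact Submodule.add_mem _ (h 0 _ (proj_mem 0 y)) (h 1 _ (proj_mem 1 y))
  intro k y hy x v
  induction x using hom_induction with
  | hadd a b ha hb => simp only [map_add, LinearMap.add_apply, ha, hb]
  | h i x hx =>
    induction v using hom_induction with
    | hadd a b ha hb => simp only [map_add, ha, hb]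
    | h l v hv =>
      rw [homAct_apply_of_mem t X V hy (X.act_mem hx hv), homAct_apply_of_mem t X V hy hv, hf,
        map_smul, act_comm_of_sbr_eq_zero V (s.map_part hx) (t.map_part hy) (hst x y), smul_smul]
      congr 1
      rcases zmod2_cases i with rfl | rfl <;> rcases zmod2_cases k with rfl | rfl <;>
        rcases zmod2_cases l with rfl | rfl <;> simp [zmod2_one_add_one]

/-- A nonzero intertwiner yields an irreducible multiplicity module. -/
theorem exists_isMultiplicity {s : SuperHom L L}
    (hst : ∀ x y, LieSuperalgebra.sbr (s.toLinearMap x) (t.toLinearMap y) = 0)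
    (htt : ∀ x, t.toLinearMap (t.toLinearMap x) = t.toLinearMap x)
    [FiniteDimensional ℂ X.carrier] [FiniteDimensional ℂ V.carrier]
    {g : X.carrier →ₗ[ℂ] V.carrier} (hg : g ∈ intertwiners X V s) (hg0 : g ≠ 0) :
    ∃ (Y : SuperModule.{v} L) (j : Y.carrier →ₗ[ℂ] X.carrier →ₗ[ℂ] V.carrier),
      Y.IsIrreducible ∧ FiniteDimensional ℂ Y.carrier ∧
      (∀ x v, Y.act (t.toLinearMap x) v = Y.act x v) ∧ IsMultiplicity s t X Y V j := by
  have : FiniteDimensional ℂ (homModule t X V).carrier :=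
    inferInstanceAs (FiniteDimensional ℂ (X.carrier →ₗ[ℂ] V.carrier))
  obtain ⟨S, hS, hact, hle, hirr⟩ := (homModule t X V).exists_irreducible_sub
    (intertwiners X V s) (fun h => hg0 ((Submodule.mem_bot ℂ).1 (h ▸ hg)))
    (isGraded_intertwiners X V s) (fun y f hf => homAct_mem_intertwiners t X V hst y hf)
  refine ⟨_, S.subtype, hirr, ?_, fun x f => Subtype.ext ?_, ?_, ?_, ?_, ?_⟩
  · exact inferInstanceAs (FiniteDimensional ℂ S)
  · exact homAct_idempotent t X V htt x f.1
  · exact S.injective_subtype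
  · intro f v
    exact (LinearMap.congr_fun (coe_parity_sub hS f) v).trans (parity_homSuper _ v)
  · exact fun f x v => hle f.2 x v
  · intro i k x v hx hv f
    exact homAct_apply_of_mem t X V hx hv f.1

end HomModule

end SuperModule

/-! ### Irreducible products of two modules -/

namespace SuperModule

variable {L : Type w} [AddCommGroup L] [Module ℂ L] [LieSuperalgebra L]

theorem isGraded_hatSubspace {M N : SuperModule.{v} L} {φ : M.carrier →ₗ[ℂ] M.carrier}
    {ψ : N.carrier →ₗ[ℂ] N.carrier} (hφ : IsOddStructure M φ) (hψ : IsOddStructure N ψ) :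
    IsGraded (hatSubspace M N φ ψ) :=
  fun t ht i => (oddTensor_proj hφ hψ i t).trans (congrArg (proj i) ht)

namespace IsMultiplicity

variable {s t : SuperHom L L} {X Y V : SuperModule.{v} L}
  {j : Y.carrier →ₗ[ℂ] X.carrier →ₗ[ℂ] V.carrier}

theorem evalMap_ne_zero (h : IsMultiplicity s t X Y V j) (hY : Y.IsIrreducible) :
    evalMap j ≠ 0 := by
  have := hY.1
  obtain ⟨f, hf⟩ := exists_ne (0 : Y.carrier)
  intro h0
  refine hf (h.inj ?_)
  rw [map_zero]
  ext v
  exact LinearMap.congr_fun h0 (v ⊗ₜ f)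

theorem evenIso_tensor (h : IsMultiplicity s t X Y V j)
    (hVst : ∀ x v, V.act x v = V.act (s.toLinearMap x) v + V.act (t.toLinearMap x) v)
    (hV : V.IsIrreducible) (hY : Y.IsIrreducible) (hinj : Function.Injective (evalMap j)) :
    (tensor X Y).EvenIso V :=
  ⟨LinearEquiv.ofBijective (evalMap j) ⟨hinj, surjective_of_isIrreducible (M := tensor X Y) hV _
    (h.evalMap_act hVst) h.evalMap_parity (h.evalMap_ne_zero hY)⟩,
    fun x v => h.evalMap_act hVst x v, fun v => h.evalMap_parity v⟩

section Odd

variable {d : X.carrier →ₗ[ℂ] X.carrier} {c : Y.carrier →ₗ[ℂ] Y.carrier}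

theorem comp_parity (h : IsMultiplicity s t X Y V j)
    (hdp : ∀ v, d (SuperSpace.parity v) = -SuperSpace.parity (d v))
    (hc : ∀ f, j (c f) = j f ∘ₗ d) (f : Y.carrier) :
    c (SuperSpace.parity f) = -SuperSpace.parity (c f) :=
  h.inj ((hc _).trans (h.parity_comp hdp (hc f)).symm)

theorem comp_comp (h : IsMultiplicity s t X Y V j) (hdd : ∀ v, d (d v) = v)
    (hc : ∀ f, j (c f) = j f ∘ₗ d) (f : Y.carrier) : c (c f) = f := by
  refine h.inj (LinearMap.ext fun v => ?_)
  rw [hc, hc, LinearMap.comp_apply, LinearMap.comp_apply, hdd]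

theorem mem_of_anticomm {W : Type*} [AddCommGroup W] [Module ℂ W] [SuperSpace W] {φ : W →ₗ[ℂ] W}
    (hφ : ∀ v, φ (SuperSpace.parity v) = -SuperSpace.parity (φ v)) {i : ZMod 2} {v : W}
    (hv : v ∈ part i) : φ v ∈ part (V := W) (1 + i) := by
  have := hφ v
  rw [parity_apply hv, map_smul] at this
  rw [mem_part_iff, ← neg_inj, ← this]
  rcases zmod2_cases i with rfl | rfl <;> simp [zmod2_one_add_one]

/-- The involution `d` commutes with the action and has square 1. Composing with parity turns
commuting into supercommuting, and the square becomes -1 since parity and `d` anticommute. -/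
theorem isOddStructure_left (hdact : ∀ x v, d (X.act x v) = X.act x (d v))
    (hdp : ∀ v, d (SuperSpace.parity v) = -SuperSpace.parity (d v)) (hdd : ∀ v, d (d v) = v) :
    IsOddStructure X (SuperSpace.parity ∘ₗ d) where
  odd := mem_of_anticomm fun v => by simp [hdp]
  comm hx v := by simp [hdact, parity_act_of_mem X hx, sgn_comm 1]
  sq v := by simp [hdp, hdd, parity_parity]

/-- The operator `c` already supercommutes by `act_comp`, but c² = 1; the factor √-1 corrects the
square. -/
theorem isOddStructure_right (h : IsMultiplicity s t X Y V j)
    (hdp : ∀ v, d (SuperSpace.parity v) = -SuperSpace.parity (d v)) (hdd : ∀ v, d (d v) = v)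
    (hc : ∀ f, j (c f) = j f ∘ₗ d) : IsOddStructure Y (Complex.I • c) where
  odd := mem_of_anticomm fun v => by simp [h.comp_parity hdp hc]
  comm {i x} hx f := by
    have : c (Y.act x f) = sgn i 1 • Y.act x (c f) :=
      h.inj ((hc _).trans (h.act_comp hdp (hc f) hx).symm)
    rw [LinearMap.smul_apply, this, LinearMap.smul_apply, map_smul, smul_comm, sgn_comm]
  sq f := by simp [smul_smul, h.comp_comp hdd hc]

/-- Conjugating `d` by parity gives -d, and the two factors √-1 contribute another -1, so all signs
cancel. -/
theorem oddTensor_eq (hdp : ∀ v, d (SuperSpace.parity v) = -SuperSpace.parity (d v))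
    (u : X.carrier ⊗[ℂ] Y.carrier) :
    oddTensor X Y (SuperSpace.parity ∘ₗ d) (Complex.I • c) u = TensorProduct.map d c u := by
  induction u using TensorProduct.induction_on with
  | zero => simp
  | add a b ha hb => simp only [map_add, ha, hb]
  | tmul v f =>
    simp [oddTensor, hdp, parity_parity, TensorProduct.smul_tmul', TensorProduct.tmul_smul,
      smul_smul, TensorProduct.neg_tmul]

/-- Evaluation is blind to d ⊗ c. It therefore kills the (-1)-eigenspace, and only the fixed space
can be a copy of V. -/
theorem evalMap_map_comp (hdd : ∀ v, d (d v) = v) (hc : ∀ f, j (c f) = j f ∘ₗ d)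
    (u : X.carrier ⊗[ℂ] Y.carrier) : evalMap j (TensorProduct.map d c u) = evalMap j u := by
  induction u using TensorProduct.induction_on with
  | zero => simp
  | add a b ha hb => simp only [map_add, ha, hb]
  | tmul v f => simp [hc, hdd]

theorem map_comp_map_comp (h : IsMultiplicity s t X Y V j) (hdd : ∀ v, d (d v) = v)
    (hc : ∀ f, j (c f) = j f ∘ₗ d) (u : X.carrier ⊗[ℂ] Y.carrier) :
    TensorProduct.map d c (TensorProduct.map d c u) = u := by
  induction u using TensorProduct.induction_on with
  | zero => simp
  | add a b ha hb => simp only [map_add, ha, hb]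
  | tmul v f => simp [h.comp_comp hdd hc, hdd]

/-- The evaluation map is injective on the fixed space of `d ⊗ c`. -/
theorem eq_zero_of_evalMap_eq_zero (h : IsMultiplicity s t X Y V j)
    [FiniteDimensional ℂ X.carrier] (hX : X.IsIrreducible)
    (hdp : ∀ v, d (SuperSpace.parity v) = -SuperSpace.parity (d v)) (hdd : ∀ v, d (d v) = v)
    (hc : ∀ f, j (c f) = j f ∘ₗ d) {u : X.carrier ⊗[ℂ] Y.carrier}
    (hu : TensorProduct.map d c u = u) (h0 : evalMap j u = 0) : u = 0 := by
  -- Since `c` is odd, d ⊗ c exchanges X ⊗ Y₀ and X ⊗ Y₁, so a fixed `u` is determined by its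
  -- component in X ⊗ Y₀. Both components have the same evaluation, hence each evaluates to 0; and
  -- Y₀ consists of even maps, on which evaluation is injective.
  let q : Y.carrier →ₗ[ℂ] part (V := Y.carrier) 0 := (proj 0).codRestrict _ (proj_mem 0)
  let p : ZMod 2 → (X.carrier ⊗[ℂ] Y.carrier →ₗ[ℂ] X.carrier ⊗[ℂ] Y.carrier) := fun i =>
    TensorProduct.map LinearMap.id (proj i)
  have hsum : ∀ u, p 0 u + p 1 u = u := fun u => by
    rw [← LinearMap.add_apply, ← TensorProduct.map_add_right, proj_zero_add_proj_one_comp,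
      TensorProduct.map_id, LinearMap.id_apply]
  have hshift : ∀ u, p 1 (TensorProduct.map d c u) = TensorProduct.map d c (p 0 u) := fun u => by
    induction u using TensorProduct.induction_on with
    | zero => simp
    | add a b ha hb => simp only [map_add, ha, hb]
    | tmul v f =>
      simp [p, SuperSpace.proj_one_apply, SuperSpace.proj_zero_apply, h.comp_parity hdp hc,
        sub_eq_add_neg]
  have h1 : p 1 u = TensorProduct.map d c (p 0 u) := by rw [← hshift, hu]
  have heval : evalMap (j ∘ₗ (part (V := Y.carrier) 0).subtype)
      (TensorProduct.map LinearMap.id q u) = evalMap j (p 0 u) := by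
    clear hu h0 h1
    induction u using TensorProduct.induction_on with
    | zero => simp
    | add a b ha hb => simp only [map_add, ha, hb]
    | tmul v f => simp [p, q]
  have hinj : Function.Injective (evalMap (j ∘ₗ (part (V := Y.carrier) 0).subtype)) := by
    refine evalMap_injective_of_even hX s _ (h.inj.comp (Submodule.injective_subtype _)) ?_
      fun f => h.act_left f
    intro f v
    have := h.parity f.1 (SuperSpace.parity v)
    rw [parity_apply f.2, parity_parity, sgn_zero_left, one_smul] at this
    exact this
  have h2 : evalMap j (p 0 u) = 0 := by
    have h3 : evalMap j (p 0 u) + evalMap j (p 1 u) = 0 := by rw [← map_add, hsum, h0]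
    rw [h1, evalMap_map_comp hdd hc] at h3
    exact eq_zero_of_eq_neg (eq_neg_of_add_eq_zero_left h3)
  have h4 : TensorProduct.map LinearMap.id q u = 0 :=
    hinj (by rw [heval, h2, map_zero])
  have h5 : p 0 u = 0 := by
    have : p 0 u = TensorProduct.map LinearMap.id (part (V := Y.carrier) 0).subtype
        (TensorProduct.map LinearMap.id q u) := by
      rw [← LinearMap.comp_apply, ← TensorProduct.map_comp]
      rfl
    rw [this, h4, map_zero]
  rw [← hsum u, h1, h5, map_zero, add_zero]

theorem evenIso_hat (h : IsMultiplicity s t X Y V j) [FiniteDimensional ℂ X.carrier]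
    (hVst : ∀ x v, V.act x v = V.act (s.toLinearMap x) v + V.act (t.toLinearMap x) v)
    (hV : V.IsIrreducible) (hX : X.IsIrreducible) (hY : Y.IsIrreducible)
    (hdact : ∀ x v, d (X.act x v) = X.act x (d v))
    (hdp : ∀ v, d (SuperSpace.parity v) = -SuperSpace.parity (d v)) (hdd : ∀ v, d (d v) = v)
    (hc : ∀ f, j (c f) = j f ∘ₗ d) :
    (hat X Y _ _ (isOddStructure_left hdact hdp hdd)
      (h.isOddStructure_right hdp hdd hc)).EvenIso V := by
  set S := hatSubspace X Y (SuperSpace.parity ∘ₗ d) (Complex.I • c) with hS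
  have hmem : ∀ u, u ∈ S ↔ TensorProduct.map d c u = u := fun u => by
    rw [← oddTensor_eq (c := c) hdp]
    rfl
  have hbij : Function.Bijective (evalMap j ∘ₗ S.subtype) := by
    constructor
    · rw [← LinearMap.ker_eq_bot, LinearMap.ker_eq_bot']
      exact fun u hu => Subtype.ext
        (h.eq_zero_of_evalMap_eq_zero hX hdp hdd hc ((hmem _).1 u.2) hu)
    · intro w
      obtain ⟨u, rfl⟩ := surjective_of_isIrreducible (M := tensor X Y) hV (evalMap j)
        (h.evalMap_act hVst) h.evalMap_parity (h.evalMap_ne_zero hY) w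
      change X.carrier ⊗[ℂ] Y.carrier at u
      -- Averaging a preimage over the involution d ⊗ c makes it fixed without changing its
      -- evaluation.
      refine ⟨⟨(2⁻¹ : ℂ) • (u + TensorProduct.map d c u), (hmem _).2 ?_⟩, ?_⟩
      · rw [map_smul, map_add, h.map_comp_map_comp hdd hc, add_comm]
      · change evalMap j ((2⁻¹ : ℂ) • (u + TensorProduct.map d c u)) = evalMap j u
        rw [map_smul, map_add, evalMap_map_comp hdd hc]
        module
  refine ⟨LinearEquiv.ofBijective (evalMap j ∘ₗ S.subtype) hbij,
    fun x v => h.evalMap_act hVst x v.1, fun v => ?_⟩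
  refine Eq.trans ?_ (h.evalMap_parity v.1)
  exact congrArg (evalMap j) (coe_parity_sub (V := X.carrier ⊗[ℂ] Y.carrier)
    (isGraded_hatSubspace (isOddStructure_left hdact hdp hdd)
      (h.isOddStructure_right hdp hdd hc)) v)

end Odd

/-- An irreducible module with a multiplicity space is an irreducible product. -/
theorem exists_isIrredProd (h : IsMultiplicity s t X Y V j) [FiniteDimensional ℂ X.carrier]
    (hVst : ∀ x v, V.act x v = V.act (s.toLinearMap x) v + V.act (t.toLinearMap x) v)
    (hV : V.IsIrreducible) (hX : X.IsIrreducible) (hY : Y.IsIrreducible) :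
    ∃ P, IsIrredProd X Y P ∧ P.EvenIso V := by
  by_cases hirr : (tensor X Y).IsIrreducible
  · exact ⟨_, .tensor hirr, h.evenIso_tensor hVst hV hY (injective_of_isIrreducible hirr _
      (h.evalMap_act hVst) h.evalMap_parity (h.evalMap_ne_zero hY))⟩
  -- Evaluation is surjective onto V, so injectivity would make X ⊗ Y as irreducible as V.
  have hninj : ¬ Function.Injective (evalMap j) := fun hinj =>
    hirr ((h.evenIso_tensor hVst hV hY hinj).symm.isIrreducible hV)
  obtain ⟨N, hN, h0, h1⟩ : ∃ N : Submodule ℂ X.carrier,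
      (∀ x, ∀ v ∈ N, X.act x v ∈ N) ∧ N ≠ ⊥ ∧ N ≠ ⊤ := by
    by_contra! hcon
    exact hninj (h.evalMap_injective_of_simple fun N hN => or_iff_not_imp_left.2 (hcon N hN))
  obtain ⟨d, hdact, hdp, hdd⟩ := exists_odd_involution hX hN h0 h1
  rcases h.stable_or_disjoint hY hdp with hst | hdis
  · let c : Y.carrier →ₗ[ℂ] Y.carrier := (LinearEquiv.ofInjective j h.inj).symm.toLinearMap ∘ₗ
      (LinearMap.lcomp ℂ V.carrier d ∘ₗ j).codRestrict (LinearMap.range j) hst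
    have hc : ∀ f, j (c f) = j f ∘ₗ d := fun f => by
      have := LinearEquiv.apply_symm_apply (LinearEquiv.ofInjective j h.inj)
        ((LinearMap.lcomp ℂ V.carrier d ∘ₗ j).codRestrict (LinearMap.range j) hst f)
      exact congrArg Subtype.val this
    exact ⟨_, .hat hirr _ _ (isOddStructure_left hdact hdp hdd)
      (h.isOddStructure_right hdp hdd hc), h.evenIso_hat hVst hV hX hY hdact hdp hdd hc⟩
  · exact (hninj (h.evalMap_injective_of_disjoint hX hdact hdp hdd hdis)).elim

end IsMultiplicity

end SuperModule

/-! ### Modules over finite direct sums -/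

/-- A sum of homomorphisms with mutually commuting images. -/
def sumHom {L : Type*} [AddCommGroup L] [Module ℂ L] [LieSuperalgebra L] {k : ℕ}
    (p : Fin k → SuperHom L L) (hcomm : ∀ i j, i ≠ j → ∀ x y,
      LieSuperalgebra.sbr ((p i).toLinearMap x) ((p j).toLinearMap y) = 0) : SuperHom L L where
  toLinearMap := ∑ i, (p i).toLinearMap
  map_part hx := by
    rw [LinearMap.sum_apply]
    exact Submodule.sum_mem _ fun i _ => (p i).map_part hx
  map_sbr x y := by
    simp only [LinearMap.sum_apply, map_sum]
    refine Finset.sum_congr rfl fun i _ => ?_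
    rw [Finset.sum_eq_single i (fun j _ hj => hcomm j i hj x y) (by simp), (p i).map_sbr]

/-- The inclusion of a factor into a product of Lie superalgebras. -/
def singleHom {ι : Type*} [DecidableEq ι] {L : ι → Type*} [∀ i, AddCommGroup (L i)]
    [∀ i, Module ℂ (L i)] [∀ i, LieSuperalgebra (L i)] (i : ι) : SuperHom (L i) (∀ i, L i) where
  toLinearMap := LinearMap.single ℂ L i
  map_part {k x} hx := fun j _ => by
    rcases eq_or_ne j i with rfl | h
    · simpa using hx
    · rw [LinearMap.coe_single, Pi.single_eq_of_ne h]
      exact Submodule.zero_mem _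
  map_sbr x y := by
    funext j
    change _ = LieSuperalgebra.sbr _ _
    rcases eq_or_ne j i with rfl | h
    · simp
    · simp [Pi.single_eq_of_ne h]

/-- The composition of homomorphisms of Lie superalgebras. -/
def SuperHom.comp {L₁ L₂ L₃ : Type*} [AddCommGroup L₁] [Module ℂ L₁] [LieSuperalgebra L₁]
    [AddCommGroup L₂] [Module ℂ L₂] [LieSuperalgebra L₂]
    [AddCommGroup L₃] [Module ℂ L₃] [LieSuperalgebra L₃]
    (g : SuperHom L₂ L₃) (f : SuperHom L₁ L₂) : SuperHom L₁ L₃ where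
  toLinearMap := g.toLinearMap ∘ₗ f.toLinearMap
  map_part hx := g.map_part (f.map_part hx)
  map_sbr x y := by simp only [LinearMap.comp_apply, f.map_sbr, g.map_sbr]

namespace SuperModule

/-- A literal equality of modules is needed, because `IsIrredProdFamily` speaks of the given factors
and not of their isomorphism classes. -/
theorem pullback_eq_self {L : Type*} [AddCommGroup L] [Module ℂ L] [LieSuperalgebra L]
    (M : SuperModule L) (f : SuperHom L L) (h : ∀ x v, M.act (f.toLinearMap x) v = M.act x v) :
    M.pullback f = M := by
  have : M.act ∘ₗ f.toLinearMap = M.act := LinearMap.ext fun x => LinearMap.ext (h x)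
  obtain ⟨V, act, _, _⟩ := M
  unfold pullback
  congr

section Family

variable {L : Type w} [AddCommGroup L] [Module ℂ L] [LieSuperalgebra L]

/-- The direct sum is encoded by orthogonal idempotent endomorphisms of a single L, so all factors
and partial products are modules over the same L. The induction splits off the last idempotent `t`
from the sum `s` of the others. It starts with one factor; the empty product is treated separately.
-/
theorem exists_isIrredProdFamily (k : ℕ) : ∀ (p : Fin (k + 1) → SuperHom L L)
    (_ : ∀ i j, i ≠ j → ∀ x y,
      LieSuperalgebra.sbr ((p i).toLinearMap x) ((p j).toLinearMap y) = 0)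
    (_ : ∀ i x, (p i).toLinearMap ((p i).toLinearMap x) = (p i).toLinearMap x)
    (_ : ∀ i j, i ≠ j → ∀ x, (p i).toLinearMap ((p j).toLinearMap x) = 0)
    (V : SuperModule.{v} L) (_ : FiniteDimensional ℂ V.carrier) (_ : V.IsIrreducible)
    (_ : ∀ x v, V.act x v = V.act (∑ i, (p i).toLinearMap x) v),
    ∃ (M : Fin (k + 1) → SuperModule.{v} L) (P : SuperModule.{v} L),
      (∀ i, (M i).IsIrreducible ∧ FiniteDimensional ℂ (M i).carrier ∧
        ∀ x v, (M i).act ((p i).toLinearMap x) v = (M i).act x v) ∧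
      IsIrredProdFamily (k + 1) M P ∧ P.EvenIso V := by
  induction k with
  | zero =>
    intro p _ _ _ V hfd hirr hV
    refine ⟨fun _ => V, V, fun i => ⟨hirr, hfd, fun x v => ?_⟩, rfl, EvenIso.refl V⟩
    have hi : i = 0 := Fin.fin_one_eq_zero i
    rw [hV x, hi]
    simp
  | succ k ih =>
    intro p hcomm hidem horth V hfd hirr hV
    have hne : ∀ {i j : Fin (k + 1)}, i ≠ j → i.castSucc ≠ j.castSucc := fun h h' =>
      h (Fin.castSucc_injective _ h')
    let s := sumHom (fun i : Fin (k + 1) => p i.castSucc) fun i j h => hcomm _ _ (hne h)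
    let t := p (Fin.last (k + 1))
    have hs : ∀ x, s.toLinearMap x = ∑ i : Fin (k + 1), (p i.castSucc).toLinearMap x :=
      fun x => LinearMap.sum_apply _ _ _
    have hss : ∀ x, s.toLinearMap (s.toLinearMap x) = s.toLinearMap x := fun x => by
      simp only [hs, map_sum]
      refine Finset.sum_congr rfl fun i _ => ?_
      rw [Finset.sum_eq_single i (fun j _ hj => horth _ _ (hne hj.symm) x) (by simp), hidem]
    have hst : ∀ x y, LieSuperalgebra.sbr (s.toLinearMap x) (t.toLinearMap y) = 0 := fun x y => by
      rw [hs, map_sum, LinearMap.sum_apply]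
      exact Finset.sum_eq_zero fun i _ => hcomm _ _ (Fin.castSucc_lt_last i).ne x y
    have hVst : ∀ x v, V.act x v = V.act (s.toLinearMap x) v + V.act (t.toLinearMap x) v := by
      intro x v
      rw [hV, Fin.sum_univ_castSucc, map_add, LinearMap.add_apply, hs]
    have hVnt := hirr.1
    have hfd' : FiniteDimensional ℂ (V.pullback s).carrier := hfd
    -- The induction hypothesis replaces S, irreducible under the first k + 1 summands, by an evenly
    -- isomorphic iterated product X. Its embedding into V is a nonzero intertwiner, which supplies
    -- the last factor Y.
    obtain ⟨S, hS, hact, -, hSirr⟩ := (V.pullback s).exists_irreducible_sub ⊤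
      (top_ne_bot (α := Submodule ℂ V.carrier))
      (fun _ _ _ => Submodule.mem_top) (fun _ _ _ => Submodule.mem_top)
    have hSfd : FiniteDimensional ℂ ((V.pullback s).sub S hS hact).carrier :=
      @FiniteDimensional.finiteDimensional_submodule ℂ V.carrier _ _ _ hfd S
    obtain ⟨M, X, hM, hMX, f, hf, hfp⟩ := ih (fun i => p i.castSucc)
      (fun i j h => hcomm _ _ (hne h)) (fun i => hidem _) (fun i j h => horth _ _ (hne h))
      ((V.pullback s).sub S hS hact) hSfd hSirr (fun x v => Subtype.ext (by
        change V.act (s.toLinearMap x) v.1 = V.act (s.toLinearMap _) v.1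
        rw [← hs, hss]))
    have hX : X.IsIrreducible := (EvenIso.symm ⟨f, hf, hfp⟩).isIrreducible hSirr
    have hXfd : FiniteDimensional ℂ X.carrier := LinearEquiv.finiteDimensional f.symm
    let g : X.carrier →ₗ[ℂ] V.carrier := S.subtype ∘ₗ f.toLinearMap
    have hg : g ∈ intertwiners X V s := fun x v => congrArg Subtype.val (hf x v)
    have hg0 : g ≠ 0 := fun h => by
      have := hX.1
      obtain ⟨v, hv⟩ := exists_ne (0 : X.carrier)
      exact hv (f.injective ((Subtype.ext (LinearMap.congr_fun h v)).trans (map_zero f).symm))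
    obtain ⟨Y, j, hY, hYfd, hYt, hj⟩ :=
      exists_isMultiplicity t X V hst (hidem _) hg hg0
    obtain ⟨P, hP, hPV⟩ := hj.exists_isIrredProd hVst hirr hX hY
    refine ⟨Fin.snoc (α := fun _ => SuperModule.{v} L) M Y, P, fun i => ?_, ⟨X, ?_, ?_⟩, hPV⟩
    · induction i using Fin.lastCases with
      | last => rw [Fin.snoc_last]; exact ⟨hY, hYfd, hYt⟩
      | cast i => rw [Fin.snoc_castSucc]; exact hM i
    · simpa only [Fin.snoc_castSucc] using hMX
    · rwa [Fin.snoc_last]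

end Family

/-- An irreducible finite-dimensional module over a finite direct sum of Lie superalgebras is an
irreducible product of irreducible modules over the summands. -/
theorem exists_isOuterIrredProd {k : ℕ} {L : Fin (k + 1) → Type w} [∀ i, AddCommGroup (L i)]
    [∀ i, Module ℂ (L i)] [∀ i, LieSuperalgebra (L i)] (V : SuperModule.{v} (∀ i, L i))
    (hfd : FiniteDimensional ℂ V.carrier) (hirr : V.IsIrreducible) :
    ∃ (W : ∀ i, SuperModule.{v} (L i)) (P : SuperModule.{v} (∀ i, L i)),
      (∀ i, (W i).IsIrreducible ∧ FiniteDimensional ℂ (W i).carrier) ∧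
      IsOuterIrredProd W P ∧ P.EvenIso V := by
  let p : Fin (k + 1) → SuperHom (∀ i, L i) (∀ i, L i) := fun i =>
    (singleHom i).comp (projHom i)
  have hp : ∀ i x, (p i).toLinearMap x = Pi.single i (x i) := fun i x => rfl
  obtain ⟨M, P, hM, hMP, hPV⟩ := exists_isIrredProdFamily k p
    (fun i j hij x y => funext fun l => by
      change LieSuperalgebra.sbr ((p i).toLinearMap x l) ((p j).toLinearMap y l) = 0
      rcases eq_or_ne l i with rfl | h
      · rw [hp j, Pi.single_eq_of_ne hij, map_zero]
      · rw [hp i, Pi.single_eq_of_ne h, map_zero, LinearMap.zero_apply])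
    (fun i x => by rw [hp, hp, Pi.single_eq_same])
    (fun i j hij x => by rw [hp, hp, Pi.single_eq_of_ne hij, Pi.single_zero]) V hfd hirr
    (fun x v => by simp only [hp, Finset.univ_sum_single])
  have heq : ∀ i, ((M i).pullback (singleHom i)).pullback (projHom i) = M i := fun i =>
    (M i).pullback_eq_self (p i) (hM i).2.2
  refine ⟨fun i => (M i).pullback (singleHom i), P, fun i => ⟨⟨(hM i).1.1, fun S hS hact => ?_⟩,
    (hM i).2.1⟩, ?_, hPV⟩
  · refine (hM i).1.2 S hS fun x v hv => ?_
    rw [← (hM i).2.2]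
    exact hact (x i) v hv
  · rw [IsOuterIrredProd]
    simpa only [heq] using hMP

/-! ### Evaluation modules -/

section Descend

variable {L L' : Type*} [AddCommGroup L] [Module ℂ L] [LieSuperalgebra L]
  [AddCommGroup L'] [Module ℂ L'] [LieSuperalgebra L']

/-- A module annihilated by the kernel of a surjective homomorphism is a pullback. -/
theorem exists_eq_pullback (f : SuperHom L L') (hf : Function.Surjective f.toLinearMap)
    (V : SuperModule L) (hV : ∀ x, f.toLinearMap x = 0 → V.act x = 0) :
    ∃ V' : SuperModule L', V'.pullback f = V := by
  let a : L' →ₗ[ℂ] V.carrier →ₗ[ℂ] V.carrier :=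
    (LinearMap.ker f.toLinearMap).liftQ V.act hV ∘ₗ
      (f.toLinearMap.quotKerEquivOfSurjective hf).symm.toLinearMap
  have ha : ∀ x, a (f.toLinearMap x) = V.act x := fun x => by
    have : (f.toLinearMap.quotKerEquivOfSurjective hf).symm (f.toLinearMap x)
        = Submodule.Quotient.mk x := by
      rw [LinearEquiv.symm_apply_eq]
      rfl
    change (LinearMap.ker f.toLinearMap).liftQ V.act hV
      ((f.toLinearMap.quotKerEquivOfSurjective hf).symm (f.toLinearMap x)) = _
    rw [this]
    rfl
  -- Homogeneous elements lift to homogeneous elements, so the sign rules for V descend.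
  have hpre : ∀ {i : ZMod 2} {y : L'}, y ∈ part i → ∃ x ∈ part (V := L) i, f.toLinearMap x = y := by
    intro i y hy
    obtain ⟨x, rfl⟩ := hf y
    exact ⟨proj i x, proj_mem i x, by rw [← proj_map, proj_same hy]⟩
  refine ⟨{ carrier := V.carrier, act := a, act_mem := ?_, act_sbr := ?_ }, ?_⟩
  · intro i j y v hy hv
    obtain ⟨x, hx, rfl⟩ := hpre hy
    rw [ha]
    exact V.act_mem hx hv
  · intro i j y z hy hz v
    obtain ⟨x, hx, rfl⟩ := hpre hy
    obtain ⟨x', hx', rfl⟩ := hpre hz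
    rw [← f.map_sbr, ha, ha, ha]
    exact V.act_sbr hx hx' v
  · have : a ∘ₗ f.toLinearMap = V.act := LinearMap.ext ha
    obtain ⟨W, act, _, _⟩ := V
    unfold pullback
    congr

end Descend

/-! ### Kernel of the evaluation map, annihilators and supports -/

section Evaluation

variable {L : Type w} [AddCommGroup L] [Module ℂ L] [LieSuperalgebra L]
  {A : Type u} [CommRing A] [Algebra ℂ A]

theorem pairwise_isCoprime {R : Type*} [CommRing R] {k : ℕ} {m : Fin k → MaximalSpectrum R} (hm : Function.Injective m) :
    Pairwise (Function.onFun IsCoprime fun i => (m i).asIdeal) := fun i j hij =>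
  Ideal.isCoprime_of_isMaximal (I := (m i).asIdeal) (J := (m j).asIdeal)
    fun h => hij (hm (MaximalSpectrum.ext h))

/-- Chinese remainder theorem; the `e i` are idempotent only modulo the intersection of the ideals.
-/
theorem exists_idempotents {R : Type*} [CommRing R] {k : ℕ} {m : Fin k → MaximalSpectrum R}
    (hm : Function.Injective m) :
    ∃ e : Fin k → R, (∀ i, e i - 1 ∈ (m i).asIdeal) ∧ ∀ i j, i ≠ j → e i ∈ (m j).asIdeal := by
  have h : ∀ i, ∃ r : R, ∀ j, r - (Pi.single i 1 : Fin k → R) j ∈ (m j).asIdeal := fun i =>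
    Ideal.exists_forall_sub_mem_ideal (pairwise_isCoprime hm) _
  choose e he using h
  refine ⟨e, fun i => ?_, fun i j hij => ?_⟩
  · simpa using he i i
  · simpa [Pi.single_eq_of_ne hij.symm] using he i j

theorem ev_tmul {k : ℕ} (m : Fin k → MaximalSpectrum A) (x : L) (a : A) (i : Fin k) :
    (ev m).toLinearMap (x ⊗ₜ[ℂ] a) i = x ⊗ₜ[ℂ] Ideal.Quotient.mk (m i).asIdeal a := rfl

theorem ev_surjective {k : ℕ} {m : Fin k → MaximalSpectrum A} (hm : Function.Injective m) :
    Function.Surjective (ev (L := L) m).toLinearMap := by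
  obtain ⟨e, he, he'⟩ := exists_idempotents hm
  have key : ∀ i (y : L ⊗[ℂ] (A ⧸ (m i).asIdeal)),
      Pi.single i y ∈ LinearMap.range (ev (L := L) m).toLinearMap := by
    intro i y
    induction y using TensorProduct.induction_on with
    | zero => rw [Pi.single_zero]; exact Submodule.zero_mem _
    | add y z hy hz => rw [Pi.single_add]; exact Submodule.add_mem _ hy hz
    | tmul x a =>
      obtain ⟨a, rfl⟩ := Ideal.Quotient.mk_surjective a
      refine ⟨x ⊗ₜ (e i * a), funext fun j => ?_⟩
      rw [ev_tmul]
      rcases eq_or_ne j i with rfl | h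
      · rw [Pi.single_eq_same]
        congr 1
        rw [Ideal.Quotient.eq, show e j * a - a = (e j - 1) * a by ring]
        exact Ideal.mul_mem_right _ _ (he j)
      · rw [Pi.single_eq_of_ne h, Ideal.Quotient.eq_zero_iff_mem.2
          (Ideal.mul_mem_right _ _ (he' i j h.symm)), TensorProduct.tmul_zero]
  intro y
  have : y ∈ LinearMap.range (ev (L := L) m).toLinearMap := by
    rw [← Finset.univ_sum_single y]
    exact Submodule.sum_mem _ fun i _ => key i _
  exact this

/-- Since a - Σ eᵢ a lies in every mⱼ, the action of t is the sum of the actions of the eᵢ t. By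
right exactness of the tensor product, t vanishing at mᵢ comes from L ⊗ mᵢ, and eᵢ mᵢ is contained
in every mⱼ. -/
theorem act_eq_zero_of_ev_eq_zero {k : ℕ} {m : Fin k → MaximalSpectrum A}
    (hm : Function.Injective m) (V : SuperModule.{v} (L ⊗[ℂ] A))
    (hV : ∀ x : L, ∀ a : A, (∀ i, a ∈ (m i).asIdeal) → V.act (x ⊗ₜ a) = 0) (t : L ⊗[ℂ] A)
    (ht : (ev m).toLinearMap t = 0) : V.act t = 0 := by
  obtain ⟨e, he, he'⟩ := exists_idempotents hm
  let G : Fin k → (L ⊗[ℂ] A →ₗ[ℂ] V.carrier →ₗ[ℂ] V.carrier) := fun i =>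
    V.act ∘ₗ LinearMap.lTensor L (LinearMap.mulLeft ℂ (e i))
  have hsum : V.act = ∑ i, G i := by
    refine TensorProduct.ext' fun x a => ?_
    rw [← sub_eq_zero, LinearMap.sum_apply]
    have : V.act (x ⊗ₜ a) - ∑ i, G i (x ⊗ₜ a) = V.act (x ⊗ₜ (a - ∑ i, e i * a)) := by
      simp [G, TensorProduct.tmul_sub, TensorProduct.tmul_sum]
    rw [this]
    refine hV x _ fun j => ?_
    rw [← Finset.add_sum_erase _ _ (Finset.mem_univ j),
      show ∀ c, a - (e j * a + c) = -((e j - 1) * a) - c by intro c; ring]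
    refine Ideal.sub_mem _ (neg_mem (Ideal.mul_mem_right _ _ (he j)))
      (Ideal.sum_mem _ fun i hi => Ideal.mul_mem_right _ _ (he' i j (Finset.ne_of_mem_erase hi)))
  rw [hsum, LinearMap.sum_apply]
  refine Finset.sum_eq_zero fun i _ => ?_
  have hex : Function.Exact (((m i).asIdeal.restrictScalars ℂ).subtype)
      (Ideal.Quotient.mkₐ ℂ (m i).asIdeal).toLinearMap := by
    intro a
    simp [Ideal.Quotient.eq_zero_iff_mem]
  obtain ⟨r, rfl⟩ := (lTensor_exact L hex (Ideal.Quotient.mkₐ_surjective ℂ _) t).1 (congrFun ht i)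
  clear ht
  induction r using TensorProduct.induction_on with
  | zero => simp
  | add r r' h h' => rw [map_add, map_add, h, h', add_zero]
  | tmul x a =>
    change V.act (x ⊗ₜ (e i * a.1)) = 0
    refine hV x _ fun j => ?_
    rcases eq_or_ne i j with rfl | h
    · exact Ideal.mul_mem_left _ _ a.2
    · exact Ideal.mul_mem_right _ _ (he' i j h)

theorem act_eq_zero_of_mem_annihilator (V : SuperModule.{v} (L ⊗[ℂ] A)) (x : L) {a : A}
    (ha : a ∈ V.annihilator) : V.act (x ⊗ₜ a) = 0 := by
  -- The condition is imposed on all multiples of `a`, which makes the set an ideal; it contains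
  -- every ideal in the sum defining the annihilator.
  let I : Ideal A :=
    { carrier := {a | ∀ b, V.act (x ⊗ₜ (b * a)) = 0}
      zero_mem' := by simp
      add_mem' := fun h h' b => by rw [mul_add, TensorProduct.tmul_add, map_add, h, h', add_zero]
      smul_mem' := fun c a h b => by rw [smul_eq_mul, ← mul_assoc]; exact h _ }
  have hle : V.annihilator ≤ I := sSup_le fun J hJ a ha b =>
    LinearMap.ext fun v => hJ x _ (J.mul_mem_left b ha) v
  simpa using hle ha 1

theorem le_annihilator {V : SuperModule.{v} (L ⊗[ℂ] A)} {I : Ideal A}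
    (h : ∀ x : L, ∀ a ∈ I, ∀ v : V.carrier, V.act (x ⊗ₜ[ℂ] a) v = 0) : I ≤ V.annihilator :=
  le_sSup h

/-- An irreducible module with zero action is isomorphic to the trivial module. -/
theorem iso_trivial (V : SuperModule.{v} L) (hirr : V.IsIrreducible) (h : V.act = 0) :
    V.Iso (trivial L) := by
  have := hirr.1
  obtain ⟨w, hw⟩ := exists_ne (0 : V.carrier)
  -- A homogeneous vector spans a graded line. It may be odd, whereas `trivial` is even, so the
  -- resulting isomorphism need not preserve parity.
  obtain ⟨i, v, hv, hv0⟩ : ∃ i, ∃ v ∈ part (V := V.carrier) i, v ≠ 0 := by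
    by_contra! hcon
    refine hw ?_
    rw [← proj_add w, hcon 0 _ (proj_mem 0 w), hcon 1 _ (proj_mem 1 w), add_zero]
  have htop : Submodule.span ℂ {v} = ⊤ := by
    refine (hirr.2 (Submodule.span ℂ {v}) (isGraded_iff.2 fun u hu => ?_) fun x u hu => ?_
      ).resolve_left fun h => hv0 (Submodule.span_singleton_eq_bot.1 h)
    · obtain ⟨c, rfl⟩ := Submodule.mem_span_singleton.1 hu
      rw [map_smul, parity_apply hv]
      exact Submodule.smul_mem _ _ (Submodule.smul_mem _ _ (Submodule.mem_span_singleton_self v))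
    · rw [h]
      exact Submodule.zero_mem _
  let e : ℂ ≃ₗ[ℂ] V.carrier := (LinearEquiv.toSpanNonzeroSingleton ℂ V.carrier v hv0).trans
    ((LinearEquiv.ofEq _ _ htop).trans Submodule.topEquiv)
  refine ⟨e.symm.trans ULift.moduleEquiv.symm, fun x u => ?_⟩
  rw [h]
  exact map_zero _

theorem isIrredProdOfEvaluations_of_support (V : SuperModule.{v} (L ⊗[ℂ] A))
    [Algebra.FiniteType ℂ A] (hfin : FiniteDimensional ℂ V.carrier) (hirr : V.IsIrreducible)
    (hs : V.support.Finite) (hr : V.HasReducedSupport) : V.IsIrredProdOfEvaluations := by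
  obtain ⟨k, m, hm, hmem⟩ : ∃ (k : ℕ) (m : Fin k → MaximalSpectrum A), Function.Injective m ∧
      ∀ q ∈ V.support, ∃ i, m i = q := by
    have : Finite V.support := hs
    obtain ⟨k, ⟨φ⟩⟩ := Finite.exists_equiv_fin V.support
    exact ⟨k, fun i => (φ.symm i).1, Subtype.val_injective.comp φ.symm.injective,
      fun q hq => ⟨φ ⟨q, hq⟩, by simp⟩⟩
  have hann : ∀ a, (∀ i, a ∈ (m i).asIdeal) → a ∈ V.annihilator := by
    intro a ha
    -- In a Jacobson ring a radical ideal is the intersection of the maximal ideals above it, which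
    -- here are the points of the support.
    have : IsJacobsonRing A := isJacobsonRing_of_finiteType (A := ℂ)
    rw [← hr.radical, Ideal.radical_eq_jacobson, Ideal.jacobson, Ideal.mem_sInf]
    rintro J ⟨hJ, hJmax⟩
    obtain ⟨i, hi⟩ := hmem ⟨J, hJmax⟩ hJ
    have := ha i
    rwa [hi] at this
  have hact : ∀ x : L, ∀ a : A, (∀ i, a ∈ (m i).asIdeal) → V.act (x ⊗ₜ a) = 0 := fun x a ha =>
    V.act_eq_zero_of_mem_annihilator x (hann a ha)
  obtain ⟨V', hV'⟩ := exists_eq_pullback (ev m) (ev_surjective hm) V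
    (V.act_eq_zero_of_ev_eq_zero hm hact)
  subst hV'
  cases k with
  -- With empty support the direct sum is the zero Lie superalgebra, so the action vanishes and V is
  -- trivial.
  | zero =>
    refine ⟨0, m, fun i => i.elim0, trivial _, hm, fun i => i.elim0, rfl, ?_⟩
    have h0 : V'.act = 0 := LinearMap.ext fun x => by
      rw [Subsingleton.elim x 0, map_zero, map_zero]
    obtain ⟨f, hf⟩ := V'.iso_trivial ⟨hirr.1, fun S hS _ => hirr.2 S hS fun x v _ => by
      change V'.act _ v ∈ S
      rw [h0]
      exact S.zero_mem⟩ h0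
    exact ⟨f, fun x v => hf _ v⟩
  | succ k =>
    obtain ⟨W, P, hW, hWP, hPV⟩ := exists_isOuterIrredProd V' hfin
      ⟨hirr.1, fun S hS hact => hirr.2 S hS fun x v hv => hact _ v hv⟩
    obtain ⟨f, hf⟩ := hPV.symm.iso
    exact ⟨k + 1, m, W, P, hm, hW, hWP, f, fun x v => hf _ v⟩

theorem support_of_isIrredProdOfEvaluations (V : SuperModule.{v} (L ⊗[ℂ] A))
    (hV : V.IsIrredProdOfEvaluations) : V.support.Finite ∧ V.HasReducedSupport := by
  obtain ⟨k, m, W, P, hm, -, -, f, hf⟩ := hV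
  have hle : (⨅ i, (m i).asIdeal) ≤ V.annihilator := by
    refine le_annihilator fun x a ha v => f.injective ?_
    rw [hf, map_zero]
    have : (ev m).toLinearMap (x ⊗ₜ[ℂ] a) = 0 := funext fun i => by
      rw [ev_tmul, Ideal.Quotient.eq_zero_iff_mem.2 ((Submodule.mem_iInf _).1 ha i),
        TensorProduct.tmul_zero]
      rfl
    change P.act ((ev m).toLinearMap (x ⊗ₜ[ℂ] a)) (f v) = 0
    rw [this, map_zero]
    rfl
  constructor
  · refine (Set.finite_range m).subset fun q hq => ?_
    -- A prime ideal containing a finite intersection contains one of the ideals, and maximality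
    -- then gives equality.
    have hq' : Finset.univ.inf (fun i => (m i).asIdeal) ≤ q.asIdeal := by
      rw [Finset.inf_univ_eq_iInf]
      exact hle.trans hq
    obtain ⟨i, -, hi⟩ := q.isMaximal.isPrime.inf_le'.1 hq'
    exact ⟨i, MaximalSpectrum.ext ((m i).isMaximal.eq_of_le q.isMaximal.ne_top hi)⟩
  · refine (Ideal.isRadical_iff_pow_one_lt 2 one_lt_two).2 fun a ha => ?_
    -- A finite product of fields is von Neumann regular: inverses of `a` modulo the mᵢ (or 0 where
    -- `a` vanishes) glue to a `c` with a ≡ a² c modulo the intersection. Hence a² in the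
    -- annihilator implies that a is in it.
    have hinv : ∀ i, ∃ b : A, a - a ^ 2 * b ∈ (m i).asIdeal := fun i => by
      by_cases hai : a ∈ (m i).asIdeal
      · exact ⟨0, by simpa using hai⟩
      · obtain ⟨b, hb⟩ := (m i).isMaximal.exists_inv hai
        obtain ⟨c, hc, h1⟩ := hb
        refine ⟨b, ?_⟩
        rw [show a - a ^ 2 * b = a * (1 - b * a) by ring, ← h1, add_sub_cancel_left]
        exact Ideal.mul_mem_left _ _ hc
    choose b hb using hinv
    obtain ⟨c, hc⟩ := Ideal.exists_forall_sub_mem_ideal (pairwise_isCoprime hm) b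
    have h1 : a - a ^ 2 * c ∈ V.annihilator := hle ((Submodule.mem_iInf _).2 fun i => by
      rw [show a - a ^ 2 * c = (a - a ^ 2 * b i) - a ^ 2 * (c - b i) by ring]
      exact Ideal.sub_mem _ (hb i) (Ideal.mul_mem_left _ _ (hc i)))
    rw [← sub_add_cancel a (a ^ 2 * c)]
    exact Ideal.add_mem _ h1 (Ideal.mul_mem_right _ _ ha)

end Evaluation

end SuperModule

end Queer

end

theorem proposition6p6 (n : ℕ) (hn : 2 ≤ n) (A : Type u) [CommRing A] [Algebra ℂ A]
    [Algebra.FiniteType ℂ A] (V : Queer.SuperModule.{v} (Queer.QueerLie n ⊗[ℂ] A))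
    (hfin : FiniteDimensional ℂ V.carrier) (hirr : V.IsIrreducible) :
    V.IsIrredProdOfEvaluations ↔ (V.support.Finite ∧ V.HasReducedSupport) :=
  ⟨V.support_of_isIrredProdOfEvaluations, fun h =>
    V.isIrredProdOfEvaluations_of_support hfin hirr h.1 h.2⟩
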